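/- Let $\kappa$ be an infinite regular cardinal and put $\kappa' = \bigl(\sum_{\gamma<\kappa} 2^{\gamma}\bigr)^{+}$, the sum being over cardinals $\gamma<\kappa$. For a cardinal $\mu$, a $\mu$-limit or $\mu$-colimit is one indexed by a category with fewer than $\mu$ arrows. A filtered $\mu$-colimit is a $\mu$-colimit whose indexing category is filtered. Let $\mathcal C$ be a locally small category with $\kappa$-limits, reflexive coequalisers and filtered $\kappa'$-colimits. Let $\mathcal S_{\kappa'}(\mathcal C)$ be the closure of the representables, in the category of small presheaves on $\mathcal C$ (the free completion of $\mathcal C$ under small colimits, a full subcategory of $[\mathcal C^{\mathrm{op}},\mathbf{Set}]$), under $\kappa$-limits, reflexive coequalisers and filtered $\kappa'$-colimits. Let $V\colon \mathcal C\to\mathcal S_{\kappa'}(\mathcal C)$ be the restricted Yoneda embedding. Call $\mathcal C$ $\kappa$-algebraically exact if $V$ has a left adjoint which preserves $\kappa$-limits. Theorem. $\mathcal C$ is $\kappa$-algebraically exact if and only if the following four conditions hold. (E1$'$) $\mathcal C$ is Barr-exact: it is regular (it has finite limits and coequalisers of kernel pairs, and regular epimorphisms are stable under pullback) and every equivalence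 relation in $\mathcal C$ is effective, i.e. is a kernel pair. (E2$'$) Finite limits commute with filtered $\kappa'$-colimits: for each filtered category $\mathcal K$ with fewer than $\kappa'$ arrows, the functor $\operatorname{colim}\colon\mathcal C^{\mathcal K}\to\mathcal C$ preserves finite limits. (E3$'$) Regular epimorphisms are stable by $\kappa$-small products: if $|I|<\kappa$ and $e_i\colon A_i\to B_i$ is a regular epimorphism for each $i\in I$, then $\prod_{i} e_i\colon \prod_i A_i\to\prod_i B_i$ is a regular epimorphism. (E4$'$) Filtered $\kappa'$-colimits distribute over $\kappa$-small products: if $|I|<\kappa$ and, for each $i\in I$, $D_i\colon\mathcal K_i\to\mathcal C$ is a diagram on a filtered category with fewer than $\kappa'$ arrows, with colimit $X_i$, then the canonical cocone with vertex $\prod_i X_i$ under the diagram $\prod_i\mathcal K_i\to\mathcal C$, $(k_i)_i\mapsto\prod_i D_i(k_i)$, is a colimit cocone. -/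

import Mathlib

open CategoryTheory CategoryTheory.Limits

universe v u

namespace AlgExact

/-- The cardinal `κ' = (∑_{γ < κ} 2 ^ γ)⁺`, the sum being indexed by the cardinals `γ < κ`. -/
noncomputable def prime (κ : Cardinal.{v}) : Cardinal.{v} :=
  Order.succ (Cardinal.sum fun γ : Shrink.{v} (Set.Iio κ) =>
    (2 : Cardinal.{v}) ^ ((equivShrink (Set.Iio κ)).symm γ : Cardinal.{v}))

section

variable (C : Type u) [Category.{v} C]

/-- `C` has `κ`-limits: limits of all diagrams whose indexing category has fewer than `κ`
arrows. -/
def HasLimitsLT (κ : Cardinal.{v}) : Prop :=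
  ∀ (J : Type v) [SmallCategory J], HasCardinalLT (Arrow J) κ → HasLimitsOfShape J C

/-- `C` has filtered `μ`-colimits: colimits of all diagrams whose indexing category is filtered
and has fewer than `μ` arrows. -/
def HasFilteredColimitsLT (μ : Cardinal.{v}) : Prop :=
  ∀ (K : Type v) [SmallCategory K] [IsFiltered K],
    HasCardinalLT (Arrow K) μ → HasColimitsOfShape K C

variable {C}

/-- A category with `κ`-limits has `κ`-small products. -/
theorem HasLimitsLT.hasProductsOfShape {κ : Cardinal.{v}} (h : HasLimitsLT C κ)
    {I : Type v} (hI : HasCardinalLT I κ) : HasProductsOfShape I C :=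
  h (Discrete I) (hI.of_surjective (fun i => Arrow.mk (𝟙 (Discrete.mk i))) (by
    rintro ⟨⟨i⟩, ⟨j⟩, ⟨⟨h⟩⟩⟩
    obtain rfl : i = j := h
    exact ⟨i, rfl⟩))

variable (C)

/-! ### The `κ`-bounded free completion -/

/-- The closure of the representables in presheaves on `C` under `κ`-limits, reflexive
coequalisers and filtered `κ'`-colimits: the smallest class of presheaves that contains the
representables and is closed under these (co)limits. (If `C` has `κ`-limits then the small
presheaves, that is, the small colimits of representables, are closed under these operations in
all presheaves, so this is also the closure inside the category of small presheaves, the free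
completion of `C` under small colimits.) -/
inductive closure (κ : Cardinal.{v}) : ObjectProperty (Cᵒᵖ ⥤ Type v)
  | representable (X : C) : closure κ (yoneda.obj X)
  | limit {J : Type v} [SmallCategory J] (hJ : HasCardinalLT (Arrow J) κ)
      (D : J ⥤ Cᵒᵖ ⥤ Type v) (c : Cone D) (hc : IsLimit c)
      (hD : ∀ j, closure κ (D.obj j)) : closure κ c.pt
  | reflexiveCoequalizer {P Q : Cᵒᵖ ⥤ Type v} (f g : P ⟶ Q) (hfg : IsReflexivePair f g)
      (c : Cofork f g) (hc : IsColimit c) (hP : closure κ P) (hQ : closure κ Q) :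
      closure κ c.pt
  | filteredColimit {K : Type v} [SmallCategory K] (hK : IsFiltered K)
      (hK' : HasCardinalLT (Arrow K) (prime κ))
      (D : K ⥤ Cᵒᵖ ⥤ Type v) (c : Cocone D) (hc : IsColimit c)
      (hD : ∀ k, closure κ (D.obj k)) : closure κ c.pt

/-- The category `S_{κ'}(C)`, a full subcategory of the category of presheaves on `C`. -/
abbrev S (κ : Cardinal.{v}) := (closure C κ).FullSubcategory

/-- The restricted Yoneda embedding `V : C ⥤ S_{κ'}(C)`. -/
def V (κ : Cardinal.{v}) : C ⥤ S C κ :=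
  (closure C κ).lift yoneda closure.representable

/-- `C` is `κ`-algebraically exact: `V : C ⥤ S_{κ'}(C)` has a left adjoint which preserves
`κ`-limits. -/
def IsAlgebraicallyExact (κ : Cardinal.{v}) : Prop :=
  ∃ L : S C κ ⥤ C, Nonempty (L ⊣ V C κ) ∧
    ∀ (J : Type v) [SmallCategory J], HasCardinalLT (Arrow J) κ → PreservesLimitsOfShape J L

/-! ### The exactness conditions -/

variable {C} in
/-- The pair `a, b : R ⟶ X` is an equivalence relation on `X`: it is jointly monic, and for each
`T` the induced relation on the set of maps `T ⟶ X` is an equivalence relation. -/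
structure IsEquivalenceRelation {R X : C} (a b : R ⟶ X) : Prop where
  jointly_mono : ∀ ⦃T : C⦄ (r s : T ⟶ R), r ≫ a = s ≫ a → r ≫ b = s ≫ b → r = s
  equivalence : ∀ T : C, Equivalence fun x y : T ⟶ X => ∃ r : T ⟶ R, r ≫ a = x ∧ r ≫ b = y

/-- `C` is Barr-exact: it is a regular category in which each equivalence relation is effective,
that is, is the kernel pair of some morphism. -/
def IsBarrExact : Prop :=
  Regular C ∧
    ∀ ⦃R X : C⦄ (a b : R ⟶ X), IsEquivalenceRelation a b →
      ∃ (Y : C) (q : X ⟶ Y), IsKernelPair q a b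

variable {C}

/-- Finite limits commute with filtered `μ`-colimits in `C`: for each filtered `K` with fewer than
`μ` arrows, the functor `colim : (K ⥤ C) ⥤ C` preserves finite limits. -/
def FiniteLimitsCommute {μ : Cardinal.{v}} (h : HasFilteredColimitsLT C μ) : Prop :=
  ∀ (K : Type v) [SmallCategory K] [IsFiltered K] (hK : HasCardinalLT (Arrow K) μ),
    haveI := h K hK
    PreservesFiniteLimits (colim : (K ⥤ C) ⥤ C)

/-- Regular epimorphisms are stable by `κ`-small products in `C`. -/
def RegularEpisStableByProducts {κ : Cardinal.{v}} (h : HasLimitsLT C κ) : Prop :=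
  ∀ (I : Type v) (hI : HasCardinalLT I κ),
    haveI := h.hasProductsOfShape hI
    ∀ (A B : I → C) (e : ∀ i, A i ⟶ B i), (∀ i, IsRegularEpi (e i)) → IsRegularEpi (Limits.Pi.map e)

/-- Filtered `μ`-colimits distribute over `κ`-small products in `C`: given fewer than `κ` diagrams
`D i : K i ⥤ C` on filtered categories with fewer than `μ` arrows, and a colimit cocone `c i` with
vertex `X i` under each of them, the maps `∏ i, D i (k i) ⟶ ∏ i, X i` form a colimit cocone under
the diagram `k ↦ ∏ i, D i (k i)` on the product category `∀ i, K i`. -/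
def FilteredColimitsDistribute {κ : Cardinal.{v}} (h : HasLimitsLT C κ) (μ : Cardinal.{v}) : Prop :=
  ∀ (I : Type v) (hI : HasCardinalLT I κ),
    haveI := h.hasProductsOfShape hI
    ∀ (K : I → Type v) [∀ i, SmallCategory (K i)] [∀ i, IsFiltered (K i)],
      (∀ i, HasCardinalLT (Arrow (K i)) μ) →
      ∀ (D : ∀ i, K i ⥤ C) (c : ∀ i, Cocone (D i)), (∀ i, Nonempty (IsColimit (c i))) →
        Nonempty (IsColimit (coconePointwiseProduct c))

end

end AlgExact

/-!
A presheaf `P` has a reflection along `V` at `U : C` exactly when there is a universal map from `P`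
to a representable presheaf. The proof compares such maps with the *local isomorphisms*
`P ⟶ yoneda.obj U`, those which are locally surjective and locally injective for the topology of
universally extremal sieves on `C` (`extremalTopology`): a sieve covers if no pullback of it factors
through a proper subobject.

*Sufficiency.* A presheaf is directedly presented (`IsDirPres`) if it is a directed union of fewer
than `prime κ` cyclic subpresheaves, and if the sieves on which two of its elements agree are such
unions too. Every presheaf in `S C κ` is directedly presented. For products of fewer than `κ`
presheaves this is where the value of `prime κ` matters: generators of a product are families of
generators of the factors, and `2 ^< κ` is fixed by exponentiation by cardinals below `κ`
(`primePred_power_le`). In `C`, the images of the generators of a directedly generated sieve form a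
filtered diagram of fewer than `prime κ` subobjects. As filtered colimits commute with finite
limits, the colimit of this diagram is again a subobject, and the sieve covers it
(`ExactnessConditions.exists_closure`). When the sieve covers its base this colimit is the base, so
that compatible families of maps on the sieve glue (`ExactnessConditions.exists_glue`); hence a
local isomorphism from a directedly generated presheaf is universal among its maps to representables
(`ExactnessConditions.existsUnique_of_isLocalIso`). As regular epimorphisms are stable by products,
over which filtered colimits distribute, an intersection of fewer than `κ` directedly generated
covering sieves is covering (`ExactnessConditions.iInf_mem_extremalTopology`). From this, local
isomorphisms are stable under `κ`-limits (`ExactnessConditions.isLocalIso_limit`). They are stable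
under filtered colimits as these commute with finite limits (`IsLocalIso.filteredColimit`), and
under reflexive coequalisers because equivalence relations are effective
(`ExactnessConditions.isLocalIso_reflexiveCoequalizer`). By induction on the closure, each object of
`S C κ` has a local isomorphism to a representable; these are the units of the left adjoint `L` of
`V`, and stability under `κ`-limits says that `L` preserves these.

*Necessity.* `κ`-limits, filtered `prime κ`-colimits and the relevant coequalisers in `S C κ` are
computed as in sets, where the exactness conditions hold. The left adjoint `L` preserves `κ`-limits
and all colimits, and `V ⋙ L` is isomorphic to the identity, so the conditions are transported to
`C`. Although `V` does not preserve colimits, a regular epimorphism of `C` factors in `S C κ` as a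
pointwise surjection followed by a map inverted by `L` (`exists_factorisation`), and likewise `L`
inverts the comparison of a filtered colimit in `S C κ` with the one in `C` (`isIso_map_desc`);
pullbacks and products of maps inverted by `L` are inverted by `L`.
-/

namespace AlgExact

open Opposite

/-! ### Cardinal arithmetic -/

section Cardinals

open Cardinal

variable {κ : Cardinal.{v}}

/-- The cardinal `2 ^< κ`, presented as in the definition of `prime`, whose successor is
`prime κ`. -/
noncomputable def primePred (κ : Cardinal.{v}) : Cardinal.{v} :=
  Cardinal.sum fun γ : Shrink.{v} (Set.Iio κ) =>
    (2 : Cardinal.{v}) ^ ((equivShrink (Set.Iio κ)).symm γ : Cardinal.{v})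

lemma prime_eq (κ : Cardinal.{v}) : prime κ = Order.succ (primePred κ) := rfl

lemma two_power_le_primePred {γ : Cardinal.{v}} (h : γ < κ) : 2 ^ γ ≤ primePred κ := by
  have := Cardinal.le_sum (fun γ : Shrink.{v} (Set.Iio κ) =>
    (2 : Cardinal.{v}) ^ ((equivShrink (Set.Iio κ)).symm γ : Cardinal.{v}))
    (equivShrink (Set.Iio κ) ⟨γ, h⟩)
  simpa [primePred] using this

lemma le_primePred (κ : Cardinal.{v}) : κ ≤ primePred κ := by
  by_contra! h
  exact absurd (two_power_le_primePred h) (not_le.2 (Cardinal.cantor _))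

lemma mk_shrink_Iio_le_primePred (κ : Cardinal.{v}) :
    #(Shrink.{v} (Set.Iio κ)) ≤ primePred κ := by
  calc #(Shrink.{v} (Set.Iio κ)) = Cardinal.sum fun _ : Shrink.{v} (Set.Iio κ) => 1 := by simp
    _ ≤ _ := Cardinal.sum_le_sum _ _ fun i => Cardinal.one_le_iff_ne_zero.2
      (Cardinal.power_ne_zero _ two_ne_zero)

/-- The cardinal `2 ^< κ` is fixed by exponentiation by cardinals below the regular cardinal `κ`:
a function from `γ < κ` to the disjoint union of the power sets of the `δ < κ` is bounded, so takes
its values in a set of at most `2 ^ δ * 2 ^ δ` elements for a single `δ < κ`. -/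
lemma primePred_power_le (hκ : κ.IsRegular) {γ : Cardinal.{v}} (hγ : γ < κ) :
    primePred κ ^ γ ≤ primePred κ := by
  let ι := Shrink.{v} (Set.Iio κ)
  let a : ι → Cardinal.{v} := fun i => ((equivShrink (Set.Iio κ)).symm i : Cardinal.{v})
  have ha : ∀ i, a i < κ := fun i => ((equivShrink (Set.Iio κ)).symm i).2
  have ha_inj : Function.Injective a :=
    Subtype.val_injective.comp (equivShrink (Set.Iio κ)).symm.injective
  have ha_surj : ∀ c < κ, ∃ i, a i = c := fun c hc =>
    ⟨equivShrink (Set.Iio κ) ⟨c, hc⟩, by simp [a]⟩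
  let T := Σ i : ι, Set (a i).out
  have hT : #T = primePred κ := by
    simp only [T, Cardinal.mk_sigma, Cardinal.mk_set, Cardinal.mk_out]; rfl
  have hκ0 : ℵ₀ ≤ κ := hκ.aleph0_le
  have hlam : ℵ₀ ≤ primePred κ := hκ0.trans (le_primePred κ)
  let Tb : ι → Type v := fun d => {t : T // a t.1 ≤ a d}
  have hTb : ∀ d, #(Tb d) ≤ 2 ^ (a d + a d) := by
    intro d
    have emb : ∀ i (_ : a i ≤ a d), Nonempty ((a i).out ↪ (a d).out) := fun i h => by
      rw [← Cardinal.le_def, Cardinal.mk_out, Cardinal.mk_out]; exact h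
    let f : ∀ i (_ : a i ≤ a d), (a i).out ↪ (a d).out := fun i h => (emb i h).some
    -- The range of the embedding of `(a i).out` in `(a d).out` determines `i`.
    let F : Tb d → Set (a d).out × Set (a d).out := fun t =>
      (Set.range (f t.1.1 t.2), f t.1.1 t.2 '' t.1.2)
    have hF : Function.Injective F := by
      rintro ⟨⟨i, s⟩, hi⟩ ⟨⟨j, t⟩, hj⟩ h
      have h1 : Set.range (f i hi) = Set.range (f j hj) := congrArg Prod.fst h
      have h2 : f i hi '' s = f j hj '' t := congrArg Prod.snd h
      obtain rfl : i = j := ha_inj (by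
        have e1 := Cardinal.mk_range_eq (f i hi) (f i hi).injective
        have e2 := Cardinal.mk_range_eq (f j hj) (f j hj).injective
        rw [h1, e2, Cardinal.mk_out, Cardinal.mk_out] at e1
        exact e1.symm)
      obtain rfl : s = t := (f i hi).injective.image_injective h2
      rfl
    have := Cardinal.mk_le_of_injective hF
    rwa [Cardinal.mk_prod, Cardinal.lift_id, Cardinal.mk_set, Cardinal.mk_out,
      ← Cardinal.power_add] at this
  let G : Type v := Σ d : ι, (γ.out → Tb d)
  have hG : #G ≤ primePred κ := by
    simp only [G, Cardinal.mk_sigma]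
    calc _ ≤ Cardinal.sum fun _ : ι => primePred κ := Cardinal.sum_le_sum _ _ fun d => by
          have h1 : #(γ.out → Tb d) = #(Tb d) ^ γ := by
            rw [← Cardinal.power_def, Cardinal.mk_out]
          rw [h1]
          calc #(Tb d) ^ γ ≤ (2 ^ (a d + a d)) ^ γ := Cardinal.power_le_power_right (hTb d)
            _ = 2 ^ ((a d + a d) * γ) := (Cardinal.power_mul).symm
            _ ≤ primePred κ := two_power_le_primePred
                (Cardinal.mul_lt_of_lt hκ0 (Cardinal.add_lt_of_lt hκ0 (ha d) (ha d)) hγ)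
      _ = #ι * primePred κ := by simp
      _ ≤ primePred κ * primePred κ := mul_le_mul_left (mk_shrink_Iio_le_primePred κ) _
      _ = primePred κ := Cardinal.mul_eq_self hlam
  have hsurj : Function.Surjective (fun (g : G) (x : γ.out) => (g.2 x).1) := by
    intro g
    obtain ⟨d, hd⟩ := ha_surj (⨆ x, a (g x).1)
      (Cardinal.iSup_lt_of_lt_cof_ord (by rwa [hκ.cof_ord, Cardinal.mk_out]) fun x => ha _)
    exact ⟨⟨d, fun x => ⟨g x, hd ▸ le_ciSup (f := fun x => a (g x).1)
      Cardinal.bddAbove_of_small x⟩⟩, rfl⟩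
  calc primePred κ ^ γ = #(γ.out → T) := by
        rw [← hT, ← Cardinal.power_def, Cardinal.mk_out]
    _ ≤ #G := Cardinal.mk_le_of_surjective hsurj
    _ ≤ primePred κ := hG

lemma aleph0_le_primePred (hκ : κ.IsRegular) : ℵ₀ ≤ primePred κ :=
  hκ.aleph0_le.trans (le_primePred κ)

lemma isRegular_prime (hκ : κ.IsRegular) : (prime κ).IsRegular :=
  Cardinal.isRegular_succ (aleph0_le_primePred hκ)

lemma aleph0_lt_prime (hκ : κ.IsRegular) : ℵ₀ < prime κ :=
  (aleph0_le_primePred hκ).trans_lt (Order.lt_succ _)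

/-- A product of fewer than `κ` sets with fewer than `prime κ` elements has fewer than `prime κ`
elements. -/
lemma hasCardinalLT_pi (hκ : κ.IsRegular) {J : Type v} (hJ : HasCardinalLT J κ)
    (ι : J → Type v) (hι : ∀ j, HasCardinalLT (ι j) (prime κ)) :
    HasCardinalLT (∀ j, ι j) (prime κ) := by
  simp only [hasCardinalLT_iff_cardinal_mk_lt, prime_eq, Order.lt_succ_iff] at hJ hι ⊢
  calc #(∀ j, ι j) = Cardinal.prod fun j => #(ι j) := Cardinal.mk_pi _
    _ ≤ Cardinal.prod fun _ : J => primePred κ := Cardinal.prod_le_prod _ _ hι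
    _ = primePred κ ^ #J := by simp
    _ ≤ primePred κ := primePred_power_le hκ hJ

lemma hasCardinalLT_of_arrow {J : Type v} [SmallCategory J] {μ : Cardinal.{v}}
    (hJ : HasCardinalLT (Arrow J) μ) : HasCardinalLT J μ :=
  hJ.of_injective (fun j => Arrow.mk (𝟙 j)) fun _ _ h => congrArg Comma.left h

lemma hasCardinalLT_arrow_of_preorder {ι : Type v} [Preorder ι] {μ : Cardinal.{v}}
    (hμ : ℵ₀ ≤ μ) (hι : HasCardinalLT ι μ) : HasCardinalLT (Arrow ι) μ :=
  (hasCardinalLT_prod hμ hι hι).of_injective (fun f => (f.left, f.right)) (by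
    rintro ⟨a, b, f⟩ ⟨c, d, g⟩ h
    obtain ⟨rfl, rfl⟩ : a = c ∧ b = d := by simpa using h
    obtain rfl : f = g := Subsingleton.elim _ _
    rfl)

lemma hasCardinalLT_arrow_pi (hκ : κ.IsRegular) {I : Type v} (hI : HasCardinalLT I κ)
    (K : I → Type v) [∀ i, SmallCategory (K i)]
    (hK : ∀ i, HasCardinalLT (Arrow (K i)) (prime κ)) :
    HasCardinalLT (Arrow (∀ i, K i)) (prime κ) :=
  (hasCardinalLT_pi hκ hI (fun i => Arrow (K i)) hK).of_injective
    (fun f i => Arrow.mk (f.hom i)) (by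
    rintro ⟨a, b, f⟩ ⟨c, d, g⟩ h
    obtain rfl : a = c := funext fun i => congrArg Comma.left (congrFun h i)
    obtain rfl : b = d := funext fun i => congrArg Comma.right (congrFun h i)
    obtain rfl : f = g := funext fun i => Arrow.mk_injective _ _ (congrFun h i)
    rfl)

lemma hasCardinalLT_arrow_under {K : Type v} [SmallCategory K] {μ : Cardinal.{v}}
    (hμ : ℵ₀ ≤ μ) (hK : HasCardinalLT (Arrow K) μ) (k : K) :
    HasCardinalLT (Arrow (Under k)) μ :=
  (hasCardinalLT_prod hμ hK hK).of_injective
    (fun f => (Arrow.mk f.left.hom, Arrow.mk f.hom.right)) (by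
    rintro ⟨⟨⟨⟨⟩⟩, x, f⟩, ⟨⟨⟨⟩⟩, y, g⟩, h⟩ ⟨⟨⟨⟨⟩⟩, x', f'⟩, ⟨⟨⟨⟩⟩, y', g'⟩, h'⟩ e
    have e1 : Arrow.mk f = Arrow.mk f' := congrArg Prod.fst e
    have e2 : Arrow.mk h.right = Arrow.mk h'.right := congrArg Prod.snd e
    obtain rfl : x = x' := congrArg Comma.right e1
    obtain rfl : f = f' := Arrow.mk_injective _ _ e1
    obtain rfl : y = y' := congrArg Comma.right e2
    have e3 : h.right = h'.right := Arrow.mk_injective _ _ e2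
    obtain rfl : g = g' := by
      have w1 := Under.w h
      have w2 := Under.w h'
      rw [e3] at w1
      exact w1.symm.trans w2
    obtain rfl : h = h' := Under.UnderMorphism.ext e3
    rfl)

end Cardinals

section

variable {C : Type u} [Category.{v} C]

/-! ### The extremal topology -/

variable (C) in
/-- The topology on `C` whose covering sieves are the universally extremal ones: a sieve on `X`
covers if, for each `f : Y ⟶ X`, the pulled back sieve on `Y` does not factor through a proper
subobject of `Y`. -/
def extremalTopology [HasPullbacks C] : GrothendieckTopology C where
  sieves X := {S | ∀ ⦃Y : C⦄ (f : Y ⟶ X) ⦃W : C⦄ (m : W ⟶ Y) [Mono m],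
    (∀ ⦃Z : C⦄ (g : Z ⟶ Y), S (g ≫ f) → ∃ t, t ≫ m = g) → IsIso m}
  top_mem' X Y f W m _ h := by
    obtain ⟨t, ht⟩ := h (𝟙 Y) trivial
    have : IsSplitEpi m := ⟨⟨⟨t, ht⟩⟩⟩
    exact isIso_of_mono_of_isSplitEpi m
  pullback_stable' X Y S f hS Z g W m _ h :=
    hS (g ≫ f) m fun T t ht => h t (show S ((t ≫ g) ≫ f) by rwa [Category.assoc])
  transitive' X S hS R hR Y f W m _ h := by
    refine hS f m fun Z g hg => ?_
    have : IsIso (pullback.snd m g) := hR hg (𝟙 Z) (pullback.snd m g) fun T t ht => by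
      obtain ⟨s, hs⟩ := h (t ≫ g) (by simpa using ht)
      exact ⟨pullback.lift s t hs, pullback.lift_snd _ _ _⟩
    exact ⟨inv (pullback.snd m g) ≫ pullback.fst m g, by
      rw [Category.assoc, pullback.condition, IsIso.inv_hom_id_assoc]⟩

lemma isIso_of_mem_extremalTopology [HasPullbacks C] {X W : C} {S : Sieve X}
    (hS : S ∈ extremalTopology C X) (m : W ⟶ X) [Mono m]
    (h : ∀ ⦃Z : C⦄ (g : Z ⟶ X), S g → ∃ t, t ≫ m = g) : IsIso m :=
  hS (𝟙 X) m fun _ g hg => h g (by simpa using hg)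

/-- Covering sieves of the extremal topology are jointly epimorphic. -/
lemma hom_ext_of_mem_extremalTopology [HasFiniteLimits C] {X Y : C} {S : Sieve X}
    (hS : S ∈ extremalTopology C X) {f g : X ⟶ Y}
    (h : ∀ ⦃Z : C⦄ (t : Z ⟶ X), S t → t ≫ f = t ≫ g) : f = g := by
  have : IsIso (equalizer.ι f g) := isIso_of_mem_extremalTopology hS (equalizer.ι f g)
    fun Z t ht => ⟨equalizer.lift t (h t ht), by simp⟩
  exact eq_of_epi_equalizer

/-! ### Directedly generated presheaves -/

variable {μ : Cardinal.{v}}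

variable (μ) in
/-- A presheaf is directedly `μ`-generated if it is the union of a nonempty directed family of
fewer than `μ` cyclic subpresheaves (quotients of representables): there are fewer than `μ`
elements such that each element is a restriction of one of them, and such that each two of them are
restrictions of a third. -/
def IsDirGen (P : Cᵒᵖ ⥤ Type v) : Prop :=
  ∃ (ι : Type v) (A : ι → C) (a : ∀ i, P.obj (op (A i))), HasCardinalLT ι μ ∧ Nonempty ι ∧
    (∀ i j, ∃ k, (∃ f : A i ⟶ A k, P.map f.op (a k) = a i) ∧
      ∃ f : A j ⟶ A k, P.map f.op (a k) = a j) ∧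
    ∀ (X : C) (x : P.obj (op X)), ∃ (i : ι) (f : X ⟶ A i), P.map f.op (a i) = x

/-- A sieve is directedly generated if it is so by fewer than `μ` of its own maps. -/
lemma isDirGen_functor_iff {X : C} (S : Sieve X) : IsDirGen μ S.functor ↔
    ∃ (ι : Type v) (A : ι → C) (a : ∀ i, A i ⟶ X), HasCardinalLT ι μ ∧ Nonempty ι ∧
      (∀ i j, ∃ k, (∃ f : A i ⟶ A k, f ≫ a k = a i) ∧ ∃ f : A j ⟶ A k, f ≫ a k = a j) ∧
      (∀ i, S (a i)) ∧ ∀ ⦃Y : C⦄ (g : Y ⟶ X), S g → ∃ (i : ι) (f : Y ⟶ A i), f ≫ a i = g := by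
  constructor
  · rintro ⟨ι, A, a, hι, hι', h, h'⟩
    refine ⟨ι, A, fun i => (a i).1, hι, hι', fun i j => ?_, fun i => (a i).2, fun Y g hg => ?_⟩
    · obtain ⟨k, ⟨f, hf⟩, g, hg⟩ := h i j
      exact ⟨k, ⟨f, congrArg Subtype.val hf⟩, g, congrArg Subtype.val hg⟩
    · obtain ⟨i, f, hf⟩ := h' Y ⟨g, hg⟩
      exact ⟨i, f, congrArg Subtype.val hf⟩
  · rintro ⟨ι, A, a, hι, hι', h, ha, h'⟩
    refine ⟨ι, A, fun i => ⟨a i, ha i⟩, hι, hι', fun i j => ?_, fun Y g => ?_⟩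
    · obtain ⟨k, ⟨f, hf⟩, g, hg⟩ := h i j
      exact ⟨k, ⟨f, Subtype.ext hf⟩, g, Subtype.ext hg⟩
    · obtain ⟨i, f, hf⟩ := h' g.1 g.2
      exact ⟨i, f, Subtype.ext hf⟩

lemma isDirGen_yoneda (hμ : Cardinal.aleph0 ≤ μ) (X : C) : IsDirGen μ (yoneda.obj X) :=
  ⟨PUnit, fun _ => X, fun _ => 𝟙 X, hasCardinalLT_of_finite _ _ hμ, ⟨⟨⟩⟩,
    fun _ _ => ⟨⟨⟩, ⟨𝟙 X, by simp⟩, 𝟙 X, by simp⟩, fun Y f => ⟨⟨⟩, f, by simp⟩⟩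

lemma IsDirGen.of_surjective {P Q : Cᵒᵖ ⥤ Type v} (hP : IsDirGen μ P) (φ : P ⟶ Q)
    (hφ : ∀ X, Function.Surjective (φ.app X)) : IsDirGen μ Q := by
  obtain ⟨ι, A, a, hι, hι', h, h'⟩ := hP
  refine ⟨ι, A, fun i => φ.app _ (a i), hι, hι', fun i j => ?_, fun X x => ?_⟩
  · obtain ⟨k, ⟨f, hf⟩, g, hg⟩ := h i j
    exact ⟨k, ⟨f, by rw [← NatTrans.naturality_apply, hf]⟩,
      g, by rw [← NatTrans.naturality_apply, hg]⟩
  · obtain ⟨y, rfl⟩ := hφ _ x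
    obtain ⟨i, f, rfl⟩ := h' X y
    exact ⟨i, f, by rw [← NatTrans.naturality_apply]⟩

/-- A subpresheaf of a directedly generated presheaf is directedly generated if, for each element
of the latter, the sieve on which it belongs to the subpresheaf is directedly generated. -/
lemma IsDirGen.of_injective (hμ : μ.IsRegular) {P Q : Cᵒᵖ ⥤ Type v} (hQ : IsDirGen μ Q)
    (φ : P ⟶ Q) (hφ : ∀ X, Function.Injective (φ.app X))
    (h : ∀ (X : C) (x : Q.obj (op X)), IsDirGen μ (Presheaf.imageSieve φ x).functor) :
    IsDirGen μ P := by
  have : Fact μ.IsRegular := ⟨hμ⟩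
  obtain ⟨ι, A, a, hι, hι', hd, hc⟩ := hQ
  simp only [isDirGen_functor_iff] at h
  choose κ B b hκ hκ' hd' hb hc' using fun i => h (A i) (a i)
  choose c hcb using fun i k => hb i k
  have key : ∀ {X : C} (x : P.obj (op X)) (i) (f : X ⟶ A i),
      Q.map f.op (a i) = φ.app _ x → ∃ (k : κ i) (g : X ⟶ B i k), g ≫ b i k = f ∧
        P.map g.op (c i k) = x := by
    intro X x i f hf
    obtain ⟨k, g, rfl⟩ := hc' i f ⟨x, hf.symm⟩
    refine ⟨k, g, rfl, hφ _ ?_⟩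
    rw [NatTrans.naturality_apply, hcb, ← hf]
    simp
  have key2 : ∀ i j k, (∃ f : A i ⟶ A j, Q.map f.op (a j) = a i) →
      ∃ (l : κ j) (g : B i k ⟶ B j l), P.map g.op (c j l) = c i k := by
    rintro i j k ⟨f, hf⟩
    obtain ⟨l, g, -, hg⟩ := key (c i k) j (b i k ≫ f) (by
      rw [hcb, ← hf]; simp)
    exact ⟨l, g, hg⟩
  refine ⟨Σ i, κ i, fun p => B p.1 p.2, fun p => c p.1 p.2, hasCardinalLT_sigma _ _ hι hκ,
    ⟨⟨hι'.some, (hκ' _).some⟩⟩, ?_, fun X x => ?_⟩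
  · rintro ⟨i, k⟩ ⟨i', k'⟩
    obtain ⟨j, hj, hj'⟩ := hd i i'
    obtain ⟨l, g, hg⟩ := key2 i j k hj
    obtain ⟨l', g', hg'⟩ := key2 i' j k' hj'
    obtain ⟨m, ⟨f, hf⟩, f', hf'⟩ := hd' j l l'
    have key3 : ∀ {l : κ j} {i k} {g : B i k ⟶ B j l} (f : B j l ⟶ B j m),
        P.map g.op (c j l) = c i k → f ≫ b j m = b j l →
        P.map (g ≫ f).op (c j m) = c i k := by
      intro l i k g f hg hf
      have : P.map f.op (c j m) = c j l := hφ _ (by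
        rw [NatTrans.naturality_apply, hcb, hcb, ← hf]; simp)
      rw [← hg, ← this]; simp
    exact ⟨⟨j, m⟩, ⟨g ≫ f, key3 f hg hf⟩, g' ≫ f', key3 f' hg' hf'⟩
  · obtain ⟨i, f, hf⟩ := hc X (φ.app _ x)
    obtain ⟨k, g, -, hg⟩ := key x i f hf
    exact ⟨⟨i, k⟩, g, hg⟩

/-- The product of a family of presheaves, computed on elements. -/
@[simps obj]
def piPresheaf {J : Type v} (P : J → Cᵒᵖ ⥤ Type v) : Cᵒᵖ ⥤ Type v where
  obj X := ∀ j, (P j).obj X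
  map f := ↾fun x j => (P j).map f (x j)

@[simp]
lemma piPresheaf_map_apply {J : Type v} (P : J → Cᵒᵖ ⥤ Type v) {X Y : Cᵒᵖ} (f : X ⟶ Y)
    (x : ∀ j, (P j).obj X) (j : J) :
    (piPresheaf P).map f x j = (P j).map f (x j) := rfl

variable {κ : Cardinal.{v}}

/-- Products of fewer than `κ` directedly generated presheaves are directedly generated: a family
of generators, one of each factor, gives a generator on the product of their domains. -/
lemma isDirGen_piPresheaf (hκ : κ.IsRegular) (hC : HasLimitsLT C κ) {J : Type v}
    (hJ : HasCardinalLT J κ) (P : J → Cᵒᵖ ⥤ Type v) (hP : ∀ j, IsDirGen (prime κ) (P j)) :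
    IsDirGen (prime κ) (piPresheaf P) := by
  have := hC.hasProductsOfShape hJ
  choose ι A a hι hι' hd hc using hP
  refine ⟨∀ j, ι j, fun m => ∏ᶜ fun j => A j (m j),
    fun m j => (P j).map (Pi.π (fun j => A j (m j)) j).op (a j (m j)),
    hasCardinalLT_pi hκ hJ ι hι, inferInstance, fun m n => ?_, fun X x => ?_⟩
  · choose k h h' using fun j => hd j (m j) (n j)
    choose f hf using h
    choose g hg using h'
    refine ⟨k, ⟨Limits.Pi.map f, funext fun j => ?_⟩, Limits.Pi.map g, funext fun j => ?_⟩
    · simp [← hf, ← Functor.map_comp_apply, ← op_comp]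
    · simp [← hg, ← Functor.map_comp_apply, ← op_comp]
  · choose i f hf using fun j => hc j X (x j)
    exact ⟨i, Pi.lift f, funext fun j => by simp [← hf, ← Functor.map_comp_apply, ← op_comp]⟩

lemma isDirGen_pullback [HasPullbacks C] {X Y : C} {S : Sieve X} (hS : IsDirGen μ S.functor)
    (f : Y ⟶ X) : IsDirGen μ (S.pullback f).functor := by
  rw [isDirGen_functor_iff] at hS ⊢
  obtain ⟨ι, A, a, hι, hι', hd, ha, hc⟩ := hS
  refine ⟨ι, fun i => pullback (a i) f, fun i => pullback.snd (a i) f, hι, hι', fun i j => ?_,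
    fun i => ?_, fun Z g hg => ?_⟩
  · obtain ⟨k, ⟨s, hs⟩, t, ht⟩ := hd i j
    exact ⟨k, ⟨pullback.lift (pullback.fst _ _ ≫ s) (pullback.snd _ _) (by
      simp [hs, pullback.condition]), pullback.lift_snd _ _ _⟩,
      pullback.lift (pullback.fst _ _ ≫ t) (pullback.snd _ _) (by
      simp [ht, pullback.condition]), pullback.lift_snd _ _ _⟩
  · rw [Sieve.pullback_apply, ← pullback.condition]
    exact S.downward_closed (ha i) _
  · obtain ⟨i, s, hs⟩ := hc _ hg
    exact ⟨i, pullback.lift s g hs, pullback.lift_snd _ _ _⟩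

lemma iInf_sieve_apply {J : Type*} {X Y : C} (S : J → Sieve X) (f : Y ⟶ X) :
    (⨅ j, S j) f ↔ ∀ j, S j f := by
  simp [iInf, Sieve.sInf_apply]

/-- Intersections of fewer than `κ` directedly generated sieves on `X` are directedly generated:
the wide pullback over `X` of a family of generators, one of each sieve, is a generator. It is
constructed as a pullback along the diagonal of a power of `X`. -/
lemma isDirGen_iInf [HasPullbacks C] (hκ : κ.IsRegular) (hC : HasLimitsLT C κ) {J : Type v}
    (hJ : HasCardinalLT J κ) {X : C} (S : J → Sieve X)
    (hS : ∀ j, IsDirGen (prime κ) (S j).functor) : IsDirGen (prime κ) (⨅ j, S j).functor := by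
  have := hC.hasProductsOfShape hJ
  simp only [isDirGen_functor_iff] at hS ⊢
  choose ι A a hι hι' hd ha hc using hS
  let d : X ⟶ ∏ᶜ fun _ : J => X := Pi.lift fun _ => 𝟙 X
  let e : ∀ m : ∀ j, ι j, (∏ᶜ fun j => A j (m j)) ⟶ ∏ᶜ fun _ : J => X :=
    fun m => Limits.Pi.map fun j => a j (m j)
  have he : ∀ m j, pullback.snd (e m) d = (pullback.fst (e m) d ≫ Pi.π _ j) ≫ a j (m j) := by
    intro m j
    simpa [e, d] using (pullback.condition (f := e m) (g := d) =≫ Pi.π _ j).symm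
  have hl : ∀ {Y : C} (g : Y ⟶ X) (m : ∀ j, ι j) (s : ∀ j, Y ⟶ A j (m j)),
      (∀ j, s j ≫ a j (m j) = g) → ∃ f, f ≫ pullback.snd (e m) d = g := by
    intro Y g m s hs
    exact ⟨pullback.lift (Pi.lift s) g (Pi.hom_ext _ _ fun j => by simp [e, d, hs]),
      pullback.lift_snd _ _ _⟩
  refine ⟨∀ j, ι j, fun m => pullback (e m) d, fun m => pullback.snd (e m) d,
    hasCardinalLT_pi hκ hJ ι hι, inferInstance, fun m n => ?_, fun m => ?_, fun Y g hg => ?_⟩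
  · choose k h h' using fun j => hd j (m j) (n j)
    choose f hf using h
    choose g hg using h'
    exact ⟨k, hl _ k (fun j => (pullback.fst (e m) d ≫ Pi.π _ j) ≫ f j) fun j => by
        rw [Category.assoc, hf]; exact (he m j).symm,
      hl _ k (fun j => (pullback.fst (e n) d ≫ Pi.π _ j) ≫ g j) fun j => by
        rw [Category.assoc, hg]; exact (he n j).symm⟩
  · rw [iInf_sieve_apply]
    intro j
    change (S j) (pullback.snd (e m) d)
    rw [he m j]
    exact (S j).downward_closed (ha j _) _
  · rw [iInf_sieve_apply] at hg
    choose i f hf using fun j => hc j g (hg j)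
    exact ⟨i, hl g i f hf⟩

lemma isDirGen_inf [HasPullbacks C] (hκ : κ.IsRegular) (hC : HasLimitsLT C κ) {X : C}
    {S T : Sieve X} (hS : IsDirGen (prime κ) S.functor) (hT : IsDirGen (prime κ) T.functor) :
    IsDirGen (prime κ) (S ⊓ T).functor := by
  have : S ⊓ T = ⨅ b : ULift.{v} Bool, cond b.down S T := by
    rw [← Equiv.ulift.symm.iInf_comp (g := fun b : ULift.{v} Bool => cond b.down S T), iInf_bool_eq]
    rfl
  rw [this]
  exact isDirGen_iInf hκ hC (hasCardinalLT_of_finite _ _ hκ.aleph0_le) _ fun ⟨b⟩ => by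
    cases b <;> assumption

/-- A directed union of fewer than `μ` directedly generated sieves is directedly generated. -/
lemma isDirGen_of_directed_union (hμ : μ.IsRegular) {X : C} (T : Sieve X) {ι : Type v}
    [Nonempty ι] (hι : HasCardinalLT ι μ) (S : ι → Sieve X)
    (hS : ∀ i, IsDirGen μ (S i).functor) (hd : Directed (· ≤ ·) S)
    (hT : ∀ ⦃Y : C⦄ (f : Y ⟶ X), T f ↔ ∃ i, S i f) : IsDirGen μ T.functor := by
  have : Fact μ.IsRegular := ⟨hμ⟩
  simp only [isDirGen_functor_iff] at hS ⊢
  choose κ A a hκ hκ' hd' ha hc using hS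
  refine ⟨Σ i, κ i, fun p => A p.1 p.2, fun p => a p.1 p.2, hasCardinalLT_sigma _ _ hι hκ,
    ⟨⟨Classical.arbitrary ι, (hκ' _).some⟩⟩, ?_, fun p => (hT _).2 ⟨_, ha _ _⟩, fun Y f hf => ?_⟩
  · rintro ⟨i, k⟩ ⟨i', k'⟩
    obtain ⟨j, hj, hj'⟩ := hd i i'
    obtain ⟨l, f, hf⟩ := hc j _ (hj _ (ha i k))
    obtain ⟨l', f', hf'⟩ := hc j _ (hj' _ (ha i' k'))
    obtain ⟨m, ⟨g, hg⟩, g', hg'⟩ := hd' j l l'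
    exact ⟨⟨j, m⟩, ⟨f ≫ g, by rw [Category.assoc, hg, hf]⟩,
      f' ≫ g', by rw [Category.assoc, hg', hf']⟩
  · obtain ⟨i, hi⟩ := (hT f).1 hf
    obtain ⟨k, g, hg⟩ := hc i f hi
    exact ⟨⟨i, k⟩, g, hg⟩

end

section

variable {C : Type u} [Category.{v} C]

/-! ### Elements of limits and colimits of presheaves -/

section Elements

variable {J : Type v} [SmallCategory J] {D : J ⥤ Cᵒᵖ ⥤ Type v}

lemma cone_app_map (c : Cone D) (j : J) {X Y : Cᵒᵖ} (f : X ⟶ Y) (x : c.pt.obj X) :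
    (c.π.app j).app Y (c.pt.map f x) = (D.obj j).map f ((c.π.app j).app X x) :=
  NatTrans.naturality_apply (c.π.app j) f x

lemma cone_app_w (c : Cone D) {i j : J} (f : i ⟶ j) {X : Cᵒᵖ} (x : c.pt.obj X) :
    (D.map f).app X ((c.π.app i).app X x) = (c.π.app j).app X x := by
  rw [← c.w f]; rfl

lemma cocone_app_map (c : Cocone D) (j : J) {X Y : Cᵒᵖ} (f : X ⟶ Y) (x : (D.obj j).obj X) :
    (c.ι.app j).app Y ((D.obj j).map f x) = c.pt.map f ((c.ι.app j).app X x) :=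
  NatTrans.naturality_apply (c.ι.app j) f x

lemma cocone_app_w (c : Cocone D) {i j : J} (f : i ⟶ j) {X : Cᵒᵖ} (x : (D.obj i).obj X) :
    (c.ι.app j).app X ((D.map f).app X x) = (c.ι.app i).app X x := by
  rw [← c.w f]; rfl

lemma presheaf_limit_ext {c : Cone D} (hc : IsLimit c) {X : Cᵒᵖ} {x y : c.pt.obj X}
    (h : ∀ j, (c.π.app j).app X x = (c.π.app j).app X y) : x = y :=
  Concrete.isLimit_ext _ (isLimitOfPreserves ((evaluation _ _).obj X) hc) x y h

lemma presheaf_limit_exists {c : Cone D} (hc : IsLimit c) {X : Cᵒᵖ} (x : ∀ j, (D.obj j).obj X)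
    (hx : ∀ ⦃i j⦄ (f : i ⟶ j), (D.map f).app X (x i) = x j) :
    ∃ y : c.pt.obj X, ∀ j, (c.π.app j).app X y = x j := by
  let e := Types.isLimitEquivSections (isLimitOfPreserves ((evaluation _ _).obj X) hc)
  refine ⟨e.symm ⟨x, fun f => hx f⟩, fun j => ?_⟩
  exact Types.isLimitEquivSections_symm_apply
    (isLimitOfPreserves ((evaluation _ _).obj X) hc) ⟨x, fun f => hx f⟩ j

lemma presheaf_colimit_exists {c : Cocone D} (hc : IsColimit c) {X : Cᵒᵖ} (x : c.pt.obj X) :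
    ∃ (j : J) (y : (D.obj j).obj X), (c.ι.app j).app X y = x :=
  Types.jointly_surjective_of_isColimit (isColimitOfPreserves ((evaluation _ _).obj X) hc) x

lemma presheaf_filteredColimit_eq_iff [IsFiltered J] {c : Cocone D} (hc : IsColimit c) {X : Cᵒᵖ}
    {i : J} (x y : (D.obj i).obj X) : (c.ι.app i).app X x = (c.ι.app i).app X y ↔
      ∃ (j : J) (f : i ⟶ j), (D.map f).app X x = (D.map f).app X y :=
  Types.FilteredColimit.isColimit_eq_iff' (isColimitOfPreserves ((evaluation _ _).obj X) hc) x y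

variable {P Q : Cᵒᵖ ⥤ Type v} {f g : P ⟶ Q}

lemma presheaf_coequalizer_exists {c : Cofork f g} (hc : IsColimit c) {X : Cᵒᵖ} (x : c.pt.obj X) :
    ∃ y, c.π.app X y = x := by
  have : Epi c.π := epi_of_isColimit_cofork hc
  exact (epi_iff_surjective (c.π.app X)).1 inferInstance x

/-- Elements identified in a coequaliser of presheaves are related by each equivalence relation that
contains the pair. -/
lemma presheaf_coequalizer_rel {c : Cofork f g} (hc : IsColimit c) {X : Cᵒᵖ}
    {r : Q.obj X → Q.obj X → Prop} (hr : Equivalence r)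
    (h : ∀ p, r (f.app X p) (g.app X p)) {x y : Q.obj X} (hxy : c.π.app X x = c.π.app X y) :
    r x y := by
  let hc' := isColimitCoforkMapOfIsColimit ((evaluation _ _).obj X) c.condition
    (hc.ofIsoColimit (Cofork.isoCoforkOfπ c))
  let s : Setoid (Q.obj X) := ⟨r, hr⟩
  let q : Q.obj X ⟶ Quotient s := ↾fun x => Quotient.mk s x
  have hq : f.app X ≫ q = g.app X ≫ q := by
    ext p
    exact Quotient.sound (h p)
  have : ∀ x, q x = Cofork.IsColimit.desc hc' q hq (c.π.app X x) := fun x =>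
    (ConcreteCategory.congr_hom (Cofork.IsColimit.π_desc' hc' q hq) x).symm
  have e : q x = q y := by rw [this, this, hxy]
  exact Quotient.exact e

end Elements

/-! ### Directedly presented presheaves -/

variable {μ κ : Cardinal.{v}}

/-- The sieve on which two elements of a presheaf agree. -/
def eqSieve {P : Cᵒᵖ ⥤ Type v} {X : C} (x y : P.obj (op X)) : Sieve X where
  arrows _ f := P.map f.op x = P.map f.op y
  downward_closed {Y Z} f hf g := by simp [hf]

lemma eqSieve_apply {P : Cᵒᵖ ⥤ Type v} {X Y : C} (x y : P.obj (op X)) (f : Y ⟶ X) :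
    eqSieve x y f ↔ P.map f.op x = P.map f.op y := Iff.rfl

variable (μ) in
/-- A presheaf is directedly `μ`-presented if it is directedly `μ`-generated and the sieve on which
two of its elements agree is always directedly `μ`-generated. -/
structure IsDirPres (P : Cᵒᵖ ⥤ Type v) : Prop where
  isDirGen : IsDirGen μ P
  isDirGen_eqSieve : ∀ {X : C} (x y : P.obj (op X)), IsDirGen μ (eqSieve x y).functor

lemma isDirPres_yoneda [HasFiniteLimits C] (hμ : Cardinal.aleph0 ≤ μ) (X : C) :
    IsDirPres μ (yoneda.obj X) where
  isDirGen := isDirGen_yoneda hμ X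
  isDirGen_eqSieve {Y} x y := by
    let x' : Y ⟶ X := x
    let y' : Y ⟶ X := y
    rw [isDirGen_functor_iff]
    refine ⟨PUnit, fun _ => equalizer x' y', fun _ => equalizer.ι x' y',
      hasCardinalLT_of_finite _ _ hμ, ⟨⟨⟩⟩, fun _ _ => ⟨⟨⟩, ⟨𝟙 _, by simp⟩, 𝟙 _, by simp⟩,
      fun _ => equalizer.condition x' y', fun Z g hg => ⟨⟨⟩, equalizer.lift g hg, ?_⟩⟩
    exact equalizer.lift_ι _ _

lemma eqSieve_eq_iInf {J : Type v} [SmallCategory J] {D : J ⥤ Cᵒᵖ ⥤ Type v} {c : Cone D}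
    (hc : IsLimit c) {X : C} (x y : c.pt.obj (op X)) :
    eqSieve x y = ⨅ j, eqSieve ((c.π.app j).app _ x) ((c.π.app j).app _ y) := by
  ext Y f
  rw [iInf_sieve_apply]
  simp only [eqSieve_apply]
  refine ⟨fun h j => ?_, fun h => presheaf_limit_ext hc fun j => ?_⟩
  · rw [← cone_app_map, ← cone_app_map, h]
  · rw [cone_app_map, cone_app_map]
    exact h j

/-- The sieve on which a family of elements of the presheaves of a diagram is compatible. -/
def compatSieve {J : Type v} [SmallCategory J] (D : J ⥤ Cᵒᵖ ⥤ Type v) {X : C}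
    (x : ∀ j, (D.obj j).obj (op X)) : Sieve X :=
  ⨅ f : Arrow J, eqSieve ((D.map f.hom).app _ (x f.left)) (x f.right)

lemma exists_of_compatSieve {J : Type v} [SmallCategory J] {D : J ⥤ Cᵒᵖ ⥤ Type v} {c : Cone D}
    (hc : IsLimit c) {X : C} (x : ∀ j, (D.obj j).obj (op X)) {Y : C} (f : Y ⟶ X)
    (hf : compatSieve D x f) :
    ∃ y : c.pt.obj (op Y), ∀ j, (c.π.app j).app _ y = (D.obj j).map f.op (x j) :=
  presheaf_limit_exists hc _ fun i j g => by
    have := (iInf_sieve_apply _ _).1 hf (Arrow.mk g)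
    rwa [eqSieve_apply, ← NatTrans.naturality_apply] at this

/-- `κ`-limits of directedly presented presheaves are directedly presented: the limit is the
subpresheaf of the product cut out by the equality sieves of `compatSieve`. -/
lemma IsDirPres.limit [HasPullbacks C] (hκ : κ.IsRegular) (hC : HasLimitsLT C κ)
    {J : Type v} [SmallCategory J] (hJ : HasCardinalLT (Arrow J) κ) {D : J ⥤ Cᵒᵖ ⥤ Type v}
    {c : Cone D} (hc : IsLimit c) (hD : ∀ j, IsDirPres (prime κ) (D.obj j)) :
    IsDirPres (prime κ) c.pt where
  isDirGen := by
    let φ : c.pt ⟶ piPresheaf D.obj :=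
      { app := fun X => ↾fun x j => (c.π.app j).app X x
        naturality := fun X Y f => by
          ext x
          exact funext fun j => NatTrans.naturality_apply (c.π.app j) f x }
    have hφ : ∀ X (x : c.pt.obj X) j, φ.app X x j = (c.π.app j).app X x := fun _ _ _ => rfl
    refine (isDirGen_piPresheaf hκ hC (hasCardinalLT_of_arrow hJ) D.obj
      fun j => (hD j).isDirGen).of_injective (isRegular_prime hκ) φ
      (fun X x y h => presheaf_limit_ext hc fun j => congrFun h j) fun X x => ?_
    have : Presheaf.imageSieve φ x = compatSieve D x := by
      ext Y f
      refine ⟨?_, fun h => ?_⟩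
      · rintro ⟨y, hy⟩
        refine (iInf_sieve_apply _ _).2 fun g => ?_
        have h1 : ∀ j, (c.π.app j).app _ y = (D.obj j).map f.op (x j) := fun j => congrFun hy j
        rw [eqSieve_apply, ← NatTrans.naturality_apply (D.map g.hom)]
        exact ((congrArg _ (h1 _)).symm.trans (cone_app_w c g.hom y)).trans (h1 _)
      · obtain ⟨y, hy⟩ := exists_of_compatSieve hc x f h
        exact ⟨y, funext hy⟩
    rw [this]
    exact isDirGen_iInf hκ hC hJ _ fun f => (hD _).isDirGen_eqSieve _ _
  isDirGen_eqSieve x y := by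
    rw [eqSieve_eq_iInf hc]
    exact isDirGen_iInf hκ hC (hasCardinalLT_of_arrow hJ) _ fun j => (hD j).isDirGen_eqSieve _ _

/-- Filtered colimits of directedly presented presheaves are directedly presented: the equality
sieves in the colimit are directed unions of the equality sieves at the later stages. -/
lemma IsDirPres.filteredColimit (hμ : μ.IsRegular)
    {K : Type v} [SmallCategory K] [IsFiltered K] (hK : HasCardinalLT (Arrow K) μ)
    {D : K ⥤ Cᵒᵖ ⥤ Type v} {c : Cocone D} (hc : IsColimit c)
    (hD : ∀ k, IsDirPres μ (D.obj k)) : IsDirPres μ c.pt where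
  isDirGen := by
    have : Fact μ.IsRegular := ⟨hμ⟩
    choose ι A a hι hι' hd hcof using fun k => (hD k).isDirGen
    refine ⟨Σ k, ι k, fun p => A p.1 p.2, fun p => (c.ι.app p.1).app _ (a p.1 p.2),
      hasCardinalLT_sigma _ _ (hasCardinalLT_of_arrow hK) hι,
      ⟨⟨IsFiltered.nonempty.some, (hι' _).some⟩⟩, ?_, fun X x => ?_⟩
    · rintro ⟨k, i⟩ ⟨k', i'⟩
      have key : ∀ {k l : K} (s : k ⟶ l) (i : ι k), ∃ (m : ι l) (f : A k i ⟶ A l m),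
          c.pt.map f.op ((c.ι.app l).app _ (a l m)) = (c.ι.app k).app _ (a k i) := by
        intro k l s i
        obtain ⟨m, f, hf⟩ := hcof l _ ((D.map s).app _ (a k i))
        refine ⟨m, f, ?_⟩
        rw [← cocone_app_map, hf, cocone_app_w]
      obtain ⟨m, f, hf⟩ := key (IsFiltered.leftToMax k k') i
      obtain ⟨m', f', hf'⟩ := key (IsFiltered.rightToMax k k') i'
      obtain ⟨n, ⟨g, hg⟩, g', hg'⟩ := hd _ m m'
      refine ⟨⟨_, n⟩, ⟨f ≫ g, ?_⟩, f' ≫ g', ?_⟩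
      · rw [op_comp, Functor.map_comp_apply, ← cocone_app_map, hg, hf]
      · rw [op_comp, Functor.map_comp_apply, ← cocone_app_map, hg', hf']
    · obtain ⟨k, y, rfl⟩ := presheaf_colimit_exists hc x
      obtain ⟨i, f, rfl⟩ := hcof k X y
      exact ⟨⟨k, i⟩, f, (cocone_app_map c k f.op (a k i)).symm⟩
  isDirGen_eqSieve {X} x y := by
    obtain ⟨k, x, rfl⟩ := presheaf_colimit_exists hc x
    obtain ⟨l, y, rfl⟩ := presheaf_colimit_exists hc y
    obtain ⟨m, s, t, -⟩ := IsFilteredOrEmpty.cocone_objs k l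
    obtain ⟨x', hx'⟩ : ∃ x', (c.ι.app m).app _ x' = (c.ι.app k).app _ x :=
      ⟨(D.map s).app _ x, cocone_app_w c s x⟩
    obtain ⟨y', hy'⟩ : ∃ y', (c.ι.app m).app _ y' = (c.ι.app l).app _ y :=
      ⟨(D.map t).app _ y, cocone_app_w c t y⟩
    rw [← hx', ← hy']
    have : Nonempty (Under m) := ⟨Under.mk (𝟙 m)⟩
    refine isDirGen_of_directed_union hμ _ (ι := Under m)
      (hasCardinalLT_of_arrow (hasCardinalLT_arrow_under hμ.aleph0_le hK m))
      (fun u => eqSieve ((D.map u.hom).app _ x') ((D.map u.hom).app _ y'))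
      (fun u => (hD _).isDirGen_eqSieve _ _) ?_ fun Y f => ?_
    · have mono : ∀ {u u' : Under m} (f : u ⟶ u'),
          eqSieve ((D.map u.hom).app _ x') ((D.map u.hom).app _ y') ≤
            eqSieve ((D.map u'.hom).app _ x') ((D.map u'.hom).app _ y') := by
        intro u u' f Y g (hg : (D.obj _).map g.op _ = (D.obj _).map g.op _)
        change (D.obj _).map g.op _ = (D.obj _).map g.op _
        rw [← Under.w f]
        simp only [Functor.map_comp, NatTrans.comp_app, ConcreteCategory.comp_apply]
        rw [← NatTrans.naturality_apply (D.map f.right),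
          ← NatTrans.naturality_apply (D.map f.right), hg]
      exact fun u u' => ⟨_, mono (IsFiltered.leftToMax u u'), mono (IsFiltered.rightToMax u u')⟩
    · change c.pt.map f.op _ = c.pt.map f.op _ ↔ ∃ u : Under m, (D.obj _).map f.op _ =
        (D.obj _).map f.op _
      rw [← NatTrans.naturality_apply, ← NatTrans.naturality_apply,
        presheaf_filteredColimit_eq_iff hc]
      constructor
      · rintro ⟨j, g, h⟩
        exact ⟨Under.mk g, by
          rw [← NatTrans.naturality_apply, ← NatTrans.naturality_apply]; exact h⟩
      · rintro ⟨u, h⟩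
        exact ⟨_, u.hom, by rw [NatTrans.naturality_apply, NatTrans.naturality_apply]; exact h⟩

/-- If `P` is directedly generated, and a relation between maps into `X` and elements of `P` holds
on directedly generated sieves, then the maps into `X` related to some element of `P` form a
directedly generated sieve. -/
lemma isDirGen_exists [HasFiniteLimits C] (hμ : μ.IsRegular) {P : Cᵒᵖ ⥤ Type v}
    (hP : IsDirGen μ P) {X : C} (T : Sieve X)
    (S : ∀ {Y : C} (_ : Y ⟶ X) (_ : P.obj (op Y)), Sieve Y)
    (hS : ∀ {Y : C} (h : Y ⟶ X) (w : P.obj (op Y)), IsDirGen μ (S h w).functor)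
    (hS' : ∀ {Y Z : C} (h : Y ⟶ X) (w : P.obj (op Y)) (t : Z ⟶ Y),
      S h w t ↔ S (t ≫ h) (P.map t.op w) (𝟙 Z))
    (hT : ∀ {Y : C} (h : Y ⟶ X), T h ↔ ∃ w, S h w (𝟙 Y)) : IsDirGen μ T.functor := by
  have : Fact μ.IsRegular := ⟨hμ⟩
  obtain ⟨ι, A, a, hι, hι', hd, hc⟩ := hP
  simp only [isDirGen_functor_iff] at hS ⊢
  choose κ B b hκ hκ' hd' hb hc' using fun i =>
    hS (prod.fst : X ⨯ A i ⟶ X) (P.map prod.snd.op (a i))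
  have key : ∀ {Y : C} (h : Y ⟶ X) (i) (s : Y ⟶ A i), S h (P.map s.op (a i)) (𝟙 Y) →
      ∃ (k : κ i) (t : Y ⟶ B i k), t ≫ b i k = prod.lift h s := by
    intro Y h i s hs
    refine hc' i _ ((hS' _ _ _).2 ?_)
    rw [prod.lift_fst, ← Functor.map_comp_apply, ← op_comp, prod.lift_snd]
    exact hs
  have hbS : ∀ i k, S (b i k ≫ prod.fst) (P.map (b i k ≫ prod.snd).op (a i)) (𝟙 _) := by
    intro i k
    have := (hS' _ _ _).1 (hb i k)
    rwa [← Functor.map_comp_apply, ← op_comp] at this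
  refine ⟨Σ i, κ i, fun p => B p.1 p.2, fun p => b p.1 p.2 ≫ prod.fst,
    hasCardinalLT_sigma _ _ hι hκ, ⟨⟨hι'.some, (hκ' _).some⟩⟩, ?_,
    fun p => (hT _).2 ⟨_, hbS _ _⟩, fun Y h hh => ?_⟩
  · rintro ⟨i, k⟩ ⟨i', k'⟩
    dsimp only
    have key2 : ∀ {i j} (k : κ i), (∃ f : A i ⟶ A j, P.map f.op (a j) = a i) →
        ∃ (l : κ j) (t : B i k ⟶ B j l), (t ≫ b j l) ≫ prod.fst = b i k ≫ prod.fst := by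
      rintro i j k ⟨f, hf⟩
      obtain ⟨l, t, ht⟩ := key (b i k ≫ prod.fst) j ((b i k ≫ prod.snd) ≫ f) (by
        rw [op_comp, Functor.map_comp_apply, hf]
        exact hbS i k)
      exact ⟨l, t, by rw [ht, prod.lift_fst]⟩
    obtain ⟨j, hj, hj'⟩ := hd i i'
    obtain ⟨l, t, ht⟩ := key2 k hj
    obtain ⟨l', t', ht'⟩ := key2 k' hj'
    obtain ⟨m, ⟨g, hg⟩, g', hg'⟩ := hd' j l l'
    refine ⟨⟨j, m⟩, ⟨t ≫ g, ?_⟩, t' ≫ g', ?_⟩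
    · rw [← ht, ← hg]; simp
    · rw [← ht', ← hg']; simp
  · obtain ⟨w, hw⟩ := (hT h).1 hh
    obtain ⟨i, s, rfl⟩ := hc Y w
    obtain ⟨k, t, ht⟩ := key h i s hw
    exact ⟨⟨i, k⟩, t, by simp only [← Category.assoc, ht, prod.lift_fst]⟩

section Coequalizer

variable {P Q : Cᵒᵖ ⥤ Type v} (f g : P ⟶ Q)

/-- The approximations to the equivalence relation generated by a reflexive pair `f, g` of maps of
presheaves: the first is the image of the pair, and each other one is the composite of the
preceding one with its opposite. -/
def zigzag {X : Cᵒᵖ} : ℕ → Q.obj X → Q.obj X → Prop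
  | 0, x, y => ∃ p, f.app X p = x ∧ g.app X p = y
  | n + 1, x, y => ∃ w, zigzag n x w ∧ zigzag n y w

variable {f g}

lemma zigzag_map {X Y : Cᵒᵖ} (h : X ⟶ Y) : ∀ (n : ℕ) {x y : Q.obj X},
    zigzag f g n x y → zigzag f g n (Q.map h x) (Q.map h y)
  | 0, _, _, ⟨p, hp, hp'⟩ => ⟨P.map h p, by
      rw [NatTrans.naturality_apply, hp], by rw [NatTrans.naturality_apply, hp']⟩
  | n + 1, _, _, ⟨w, hw, hw'⟩ => ⟨Q.map h w, zigzag_map h n hw, zigzag_map h n hw'⟩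

lemma zigzag_refl [IsReflexivePair f g] {X : Cᵒᵖ} : ∀ (n : ℕ) (x : Q.obj X), zigzag f g n x x
  | 0, x => by
      obtain ⟨s, hs, hs'⟩ := IsReflexivePair.common_section f g
      refine ⟨s.app X x, ?_, ?_⟩
      · rw [← ConcreteCategory.comp_apply, ← NatTrans.comp_app, hs]; rfl
      · rw [← ConcreteCategory.comp_apply, ← NatTrans.comp_app, hs']; rfl
  | n + 1, x => ⟨x, zigzag_refl n x, zigzag_refl n x⟩

lemma zigzag_mono [IsReflexivePair f g] {X : Cᵒᵖ} {x y : Q.obj X} {m n : ℕ} (hmn : m ≤ n)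
    (h : zigzag f g m x y) : zigzag f g n x y := by
  induction n, hmn using Nat.le_induction with
  | base => exact h
  | succ n _ ih => exact ⟨y, ih, zigzag_refl n y⟩

lemma zigzag_symm [IsReflexivePair f g] {X : Cᵒᵖ} {n : ℕ} {x y : Q.obj X}
    (h : zigzag f g n x y) : zigzag f g (n + 1) y x :=
  ⟨y, zigzag_refl n y, h⟩

lemma equivalence_zigzag [IsReflexivePair f g] (X : Cᵒᵖ) :
    Equivalence fun x y : Q.obj X => ∃ n, zigzag f g n x y where
  refl x := ⟨0, zigzag_refl 0 x⟩
  symm := fun ⟨n, h⟩ => ⟨n + 1, zigzag_symm h⟩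
  trans := by
    rintro x y z ⟨m, h⟩ ⟨n, h'⟩
    exact ⟨max m n + 2, y, zigzag_mono (by omega) h,
      zigzag_mono (Nat.succ_le_succ (le_max_right m n)) (zigzag_symm h')⟩

variable (f g) in
/-- The sieve on which two elements are related by `zigzag`. -/
def zigzagSieve (n : ℕ) {X : C} (x y : Q.obj (op X)) : Sieve X where
  arrows _ h := zigzag f g n (Q.map h.op x) (Q.map h.op y)
  downward_closed {Y Z} h hh t := by
    have := zigzag_map t.op n hh
    simpa using this

/-- The sieves `zigzagSieve` are directedly generated, since `zigzag` is defined by existential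
quantification over `P` and `Q` and by conjunctions of equalities. -/
lemma isDirGen_zigzagSieve [HasFiniteLimits C] (hκ : κ.IsRegular) (hC : HasLimitsLT C κ)
    (hP : IsDirPres (prime κ) P) (hQ : IsDirPres (prime κ) Q) (n : ℕ) {X : C}
    (x y : Q.obj (op X)) : IsDirGen (prime κ) (zigzagSieve f g n x y).functor := by
  induction n generalizing X with
  | zero =>
    refine isDirGen_exists (isRegular_prime hκ) hP.isDirGen _
      (fun h w => eqSieve (f.app _ w) (Q.map h.op x) ⊓ eqSieve (g.app _ w) (Q.map h.op y))
      (fun h w => isDirGen_inf hκ hC (hQ.isDirGen_eqSieve _ _) (hQ.isDirGen_eqSieve _ _))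
      (fun h w t => ?_) fun h => ?_
    · simp [Sieve.inter_apply, eqSieve_apply, NatTrans.naturality_apply]
    · simp [Sieve.inter_apply, eqSieve_apply, zigzagSieve, zigzag]
  | succ n ih =>
    refine isDirGen_exists (isRegular_prime hκ) hQ.isDirGen _
      (fun h w => zigzagSieve f g n (Q.map h.op x) w ⊓ zigzagSieve f g n (Q.map h.op y) w)
      (fun h w => isDirGen_inf hκ hC (ih _ _) (ih _ _)) (fun h w t => ?_) fun h => ?_
    · simp [Sieve.inter_apply, zigzagSieve]
    · simp [Sieve.inter_apply, zigzagSieve, zigzag]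

/-- Reflexive coequalisers of directedly presented presheaves are directedly presented: an equality
sieve in the coequaliser is the union of the sequence of sieves `zigzagSieve`. -/
lemma IsDirPres.reflexiveCoequalizer [HasFiniteLimits C] (hκ : κ.IsRegular)
    (hC : HasLimitsLT C κ) (hfg : IsReflexivePair f g) {c : Cofork f g} (hc : IsColimit c)
    (hP : IsDirPres (prime κ) P) (hQ : IsDirPres (prime κ) Q) : IsDirPres (prime κ) c.pt where
  isDirGen := hQ.isDirGen.of_surjective c.π fun _ => presheaf_coequalizer_exists hc
  isDirGen_eqSieve {X} x y := by
    obtain ⟨x, rfl⟩ := presheaf_coequalizer_exists hc x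
    obtain ⟨y, rfl⟩ := presheaf_coequalizer_exists hc y
    refine isDirGen_of_directed_union (isRegular_prime hκ) _ (ι := ULift.{v} ℕ) ?_
      (fun n => zigzagSieve f g n.down x y) (fun n => isDirGen_zigzagSieve hκ hC hP hQ _ _ _)
      (fun m n => ⟨⟨max m.down n.down⟩, fun Z t ht => zigzag_mono (le_max_left _ _) ht,
        fun Z t ht => zigzag_mono (le_max_right _ _) ht⟩) fun Y t => ⟨fun h => ?_, ?_⟩
    · rw [hasCardinalLT_iff_cardinal_mk_lt]
      simpa using aleph0_lt_prime hκ
    · rw [eqSieve_apply, ← NatTrans.naturality_apply, ← NatTrans.naturality_apply] at h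
      obtain ⟨n, hn⟩ := presheaf_coequalizer_rel hc (equivalence_zigzag (f := f) (g := g) (op Y))
        (fun p => ⟨0, p, rfl, rfl⟩) h
      exact ⟨⟨n⟩, hn⟩
    · rintro ⟨n, hn⟩
      rw [eqSieve_apply, ← NatTrans.naturality_apply, ← NatTrans.naturality_apply]
      have key : ∀ (n : ℕ) {x y : Q.obj (op Y)}, zigzag f g n x y →
          c.π.app _ x = c.π.app _ y := by
        intro n
        induction n with
        | zero =>
          rintro _ _ ⟨p, rfl, rfl⟩
          exact ConcreteCategory.congr_hom (NatTrans.congr_app c.condition (op Y)) p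
        | succ n ih =>
          rintro x y ⟨w, hw, hw'⟩
          exact (ih hw).trans (ih hw').symm
      exact key n.down hn

end Coequalizer

end

section

variable {C : Type u} [Category.{v} C]

/-! ### Covers in a category satisfying the exactness conditions -/

variable {κ : Cardinal.{v}}

variable (C κ) in
/-- The exactness conditions of the characterisation, together with the existence of the limits and
filtered colimits to which they refer. -/
structure ExactnessConditions : Prop where
  isRegular : κ.IsRegular
  hasLimits : HasLimitsLT C κ
  hasFilteredColimits : HasFilteredColimitsLT C (prime κ)
  isBarrExact : IsBarrExact C
  commute : FiniteLimitsCommute hasFilteredColimits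
  products : RegularEpisStableByProducts hasLimits
  distribute : FilteredColimitsDistribute hasLimits (prime κ)

/-- Regular epimorphisms cover, since their pullbacks are strong epimorphisms. -/
lemma mem_extremalTopology_of_regularEpi [Regular C] {A X : C} (e : A ⟶ X) [IsRegularEpi e]
    {S : Sieve X} (hS : S e) : S ∈ extremalTopology C X := by
  intro Y f W m _ h
  obtain ⟨t, ht⟩ := h (pullback.snd e f) (by
    rw [← pullback.condition]
    exact S.downward_closed hS _)
  have : IsRegularEpi (pullback.snd e f) := inferInstance
  have : StrongEpi (t ≫ m) := by rw [ht]; infer_instance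
  have := strongEpi_of_strongEpi t m
  exact isIso_of_mono_of_strongEpi m

/-- A subobject of a colimit through which all coprojections factor is the whole colimit. -/
lemma isIso_of_colimit_factors {K : Type v} [SmallCategory K] {D : K ⥤ C} {c : Cocone D}
    (hc : IsColimit c) {W : C} (m : W ⟶ c.pt) [Mono m] (h : ∀ k, ∃ t, t ≫ m = c.ι.app k) :
    IsIso m := by
  choose t ht using h
  let d : c.pt ⟶ W := hc.desc
    { pt := W
      ι :=
        { app := t
          naturality := fun i j f => by
            simp [← cancel_mono m, ht] } }
  have : IsSplitEpi m := ⟨⟨⟨d, hc.hom_ext fun k => by simp [d, ht]⟩⟩⟩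
  exact isIso_of_mono_of_isSplitEpi m

/-- Colimit cocones over filtered categories are stable under pullback. -/
lemma isColimit_pullback [HasPullbacks C] {K : Type v} [SmallCategory K] [IsFiltered K]
    [HasColimitsOfShape K C] [PreservesFiniteLimits (colim : (K ⥤ C) ⥤ C)]
    {D : K ⥤ C} {c : Cocone D} (hc : IsColimit c) {Y : C} (f : Y ⟶ c.pt) :
    Nonempty (IsColimit (Cocone.mk Y (pullback.snd c.ι ((Functor.const K).map f)))) := by
  have := IsFiltered.isConnected K
  have : IsIso (colim.map c.ι) := hc.isIso_colimMap_ι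
  have h := (IsPullback.of_hasPullback c.ι ((Functor.const K).map f)).map (colim : (K ⥤ C) ⥤ C)
  rw [Cocone.isColimit_iff_isIso_colimMap_ι]
  exact h.isIso_snd_of_isIso

/-- The coprojections of a filtered colimit cover, since such colimits are stable under pullback. -/
lemma mem_extremalTopology_of_isColimit [HasPullbacks C] {K : Type v} [SmallCategory K]
    [IsFiltered K] [HasColimitsOfShape K C] [PreservesFiniteLimits (colim : (K ⥤ C) ⥤ C)]
    {D : K ⥤ C} {c : Cocone D} (hc : IsColimit c) {S : Sieve c.pt} (hS : ∀ k, S (c.ι.app k)) :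
    S ∈ extremalTopology C c.pt := by
  intro Y f W m _ h
  obtain ⟨hc'⟩ := isColimit_pullback hc f
  refine isIso_of_colimit_factors hc' m fun k => h _ ?_
  have := congrArg (fun t => t.app k) (pullback.condition (f := c.ι)
    (g := (Functor.const K).map f))
  dsimp at this ⊢
  rw [← this]
  exact S.downward_closed (hS k) _

lemma mem_extremalTopology_of_isColimit_of_regularEpi [Regular C] {K : Type v} [SmallCategory K]
    [IsFiltered K] [HasColimitsOfShape K C] [PreservesFiniteLimits (colim : (K ⥤ C) ⥤ C)]
    {D : K ⥤ C} {c : Cocone D} (hc : IsColimit c) {A : K → C} (e : ∀ k, A k ⟶ D.obj k)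
    (he : ∀ k, IsRegularEpi (e k)) {S : Sieve c.pt} (hS : ∀ k, S (e k ≫ c.ι.app k)) :
    S ∈ extremalTopology C c.pt := by
  refine (extremalTopology C).transitive (S := (extremalTopology C).close S)
    (mem_extremalTopology_of_isColimit hc fun k => ?_) S fun Y f hf => hf
  have := he k
  exact mem_extremalTopology_of_regularEpi (e k) (hS k)

/-- If two maps into a stage of a filtered diagram agree in its colimit, then they agree locally at
some later stages. -/
lemma mem_extremalTopology_of_colimit_eq [HasFiniteLimits C] {K : Type v} [SmallCategory K]
    [IsFiltered K] {k : K} [HasColimitsOfShape (Under k) C]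
    [PreservesFiniteLimits (colim : (Under k ⥤ C) ⥤ C)] {U : K ⥤ C} {c : Cocone U}
    (hc : IsColimit c) {A : C} (a b : A ⟶ U.obj k) (hab : a ≫ c.ι.app k = b ≫ c.ι.app k)
    {S : Sieve A} (hS : ∀ ⦃l : K⦄ (f : k ⟶ l) ⦃B : C⦄ (t : B ⟶ A),
      t ≫ a ≫ U.map f = t ≫ b ≫ U.map f → S t) : S ∈ extremalTopology C A := by
  have := IsFiltered.isConnected (Under k)
  -- The two maps from the constant diagram at `A` to the diagram on `Under k` have the same
  -- colimit, so their equalizer, computed at each stage, has colimit `A`.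
  let G : Under k ⥤ C := Under.forget k ⋙ U
  let stage : (A ⟶ U.obj k) → ((Functor.const (Under k)).obj A ⟶ G) := fun a =>
    { app := fun u => a ≫ U.map u.hom
      naturality := fun u u' f => by
        simp [G, ← Functor.map_comp, Under.w f] }
  have hcG : IsColimit (c.whisker (Under.forget k)) :=
    (Functor.Final.isColimitWhiskerEquiv (Under.forget k) c).symm hc
  have e : colim.map (stage a) = colim.map (stage b) := by
    let i := (colimit.isColimit G).coconePointUniqueUpToIso hcG
    have hi : ∀ u, colimit.ι G u ≫ i.hom = c.ι.app u.right := fun u =>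
      colimit.comp_coconePointUniqueUpToIso_hom hcG u
    have key : ∀ (a : A ⟶ U.obj k) (u : Under k),
        colimit.ι _ u ≫ colim.map (stage a) ≫ i.hom = a ≫ c.ι.app k := by
      intro a u
      rw [colim_map, ι_colimMap_assoc, hi, ← c.w u.hom]
      exact Category.assoc _ _ _
    rw [← cancel_mono i.hom]
    exact colimit.hom_ext fun u => by rw [key, key, hab]
  let ε := equalizer.ι (stage a) (stage b)
  have : IsIso (colim.map ε) := isIso_limit_cone_parallelPair_of_eq e
    (isLimitForkMapOfIsLimit (colim : (Under k ⥤ C) ⥤ C) _ (equalizerIsEqualizer _ _))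
  obtain ⟨hc'⟩ := (Cocone.isColimit_iff_isIso_colimMap_ι (Cocone.mk A ε)).2 this
  refine mem_extremalTopology_of_isColimit hc' fun u => hS u.hom _ ?_
  exact congrArg (fun t => t.app u) (equalizer.condition (stage a) (stage b))

/-- The images of the generators of a directedly generated sieve form a filtered diagram of
subobjects. -/
lemma exists_imageDiagram [Regular C] {μ : Cardinal.{v}} (hμ : Cardinal.aleph0 ≤ μ) {X : C}
    {T : Sieve X} (hT : IsDirGen μ T.functor) :
    ∃ (K : Type v) (_ : SmallCategory K) (_ : IsFiltered K) (_ : HasCardinalLT (Arrow K) μ)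
      (D : K ⥤ C) (m : D ⟶ (Functor.const K).obj X) (A : K → C) (e : ∀ k, A k ⟶ D.obj k),
      (∀ k, Mono (m.app k)) ∧ (∀ k, IsRegularEpi (e k)) ∧ (∀ k, T (e k ≫ m.app k)) ∧
      (∀ ⦃Y : C⦄ (g : Y ⟶ X), T g → ∃ (k : K) (f : Y ⟶ A k), f ≫ e k ≫ m.app k = g) ∧
      ∀ ⦃k l : K⦄ (f : k ⟶ l), ∃ s, s ≫ e l = e k ≫ D.map f := by
  rw [isDirGen_functor_iff] at hT
  obtain ⟨ι, A, a, hι, hι', hd, ha, hc⟩ := hT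
  -- The generators are preordered by factorisation, so that their images increase.
  let _ : Preorder ι :=
    { le := fun i j => ∃ f, f ≫ a j = a i
      le_refl := fun i => ⟨𝟙 _, Category.id_comp _⟩
      le_trans := fun i j k ⟨f, hf⟩ ⟨g, hg⟩ => ⟨f ≫ g, by rw [Category.assoc, hg, hf]⟩ }
  have : IsDirectedOrder ι := ⟨hd⟩
  let F := fun i => Regular.strongEpiMonoFactorisation (a i)
  have hF : ∀ i, (F i).e ≫ (F i).m = a i := fun i => (F i).fac
  have he : ∀ i, IsRegularEpi (F i).e := fun i => inferInstance
  have hm : ∀ i, Mono (F i).m := fun i => (F i).m_mono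
  have sq : ∀ i j (h : i ≤ j), ∃ t : (F i).I ⟶ (F j).I, t ≫ (F j).m = (F i).m := by
    rintro i j ⟨f, hf⟩
    have := he i
    have sq : CommSq (f ≫ (F j).e) (F i).e (F j).m (F i).m := ⟨by
      rw [Category.assoc, hF, hF, hf]⟩
    exact ⟨sq.lift, sq.fac_right⟩
  choose t ht using sq
  let D : ι ⥤ C :=
    { obj := fun i => (F i).I
      map := fun {i j} f => t i j (leOfHom f)
      map_id := fun i => by rw [← cancel_mono (F i).m, ht, Category.id_comp]
      map_comp := fun {i j k} f g => by
        rw [← cancel_mono (F k).m, ht, Category.assoc, ht, ht] }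
  refine ⟨ι, inferInstance, inferInstance, hasCardinalLT_arrow_of_preorder hμ hι, D,
    { app := fun i => (F i).m
      naturality := fun i j f => by
        change t i j _ ≫ (F j).m = (F i).m ≫ 𝟙 X
        rw [ht, Category.comp_id] }, A, fun i => (F i).e, hm, he, fun i => ?_, fun Y g hg => ?_,
    fun i j f => ?_⟩
  · exact (hF i).symm ▸ ha i
  · obtain ⟨i, f, hf⟩ := hc g hg
    exact ⟨i, f, by rw [← hf, ← hF]⟩
  · obtain ⟨s, hs⟩ := leOfHom f
    refine ⟨s, ?_⟩
    have := hm j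
    change s ≫ (F j).e = (F i).e ≫ t i j _
    rw [← cancel_mono (F j).m, Category.assoc, Category.assoc, hF, ht, hF, hs]

/-- Filtered colimits of subobjects are subobjects. -/
lemma mono_desc {K : Type v} [SmallCategory K]
    [IsFiltered K] [HasColimitsOfShape K C] [PreservesFiniteLimits (colim : (K ⥤ C) ⥤ C)]
    [HasPullbacks C] {D : K ⥤ C} {X : C} (m : D ⟶ (Functor.const K).obj X)
    (hm : ∀ k, Mono (m.app k)) : Mono (colimit.desc D (Cocone.mk X m)) := by
  have := IsFiltered.isConnected K
  have : Mono m := NatTrans.mono_of_mono_app m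
  have : Mono (colimMap m) := inferInstanceAs (Mono (colim.map m))
  let i : colimit ((Functor.const K).obj X) ≅ X :=
    (colimit.isColimit _).coconePointUniqueUpToIso (isColimitConstCocone K X)
  have hi : ∀ k, colimit.ι ((Functor.const K).obj X) k ≫ i.hom = 𝟙 X := fun k =>
    colimit.comp_coconePointUniqueUpToIso_hom (isColimitConstCocone K X) k
  have h : colimit.desc D (Cocone.mk X m) = colimMap m ≫ i.hom := by
    refine colimit.hom_ext fun k => ?_
    rw [colimit.ι_desc, ι_colimMap_assoc, hi]
    exact (Category.comp_id _).symm
  rw [h]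
  exact mono_comp _ _

/-- If a sieve on `X` covers a subobject of `X` through which it factors, then the maps which factor
through this subobject are those which locally belong to the sieve. -/
lemma factors_iff_mem_extremalTopology [HasPullbacks C] {X W : C} {T : Sieve X} (m : W ⟶ X)
    [Mono m]
    (hm : ∀ ⦃Y : C⦄ (f : Y ⟶ X), T f → ∃ t, t ≫ m = f)
    (hm' : T.pullback m ∈ extremalTopology C W) {Y : C} (f : Y ⟶ X) :
    (∃ t, t ≫ m = f) ↔ T.pullback f ∈ extremalTopology C Y := by
  constructor
  · rintro ⟨t, rfl⟩
    rw [Sieve.pullback_comp]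
    exact (extremalTopology C).pullback_stable t hm'
  · intro hf
    have : IsIso (pullback.snd m f) := isIso_of_mem_extremalTopology hf _ fun Z g hg => by
      obtain ⟨t, ht⟩ := hm _ hg
      exact ⟨pullback.lift t g ht, pullback.lift_snd _ _ _⟩
    exact ⟨inv (pullback.snd m f) ≫ pullback.fst m f, by
      rw [Category.assoc, pullback.condition, IsIso.inv_hom_id_assoc]⟩

lemma coconePointwiseProduct_ι_app {I : Type v} [HasProductsOfShape I C] {K : I → Type v}
    [∀ i, SmallCategory (K i)] {D : ∀ i, K i ⥤ C} (c : ∀ i, Cocone (D i)) (k : ∀ i, K i) :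
    (coconePointwiseProduct c).ι.app k = Limits.Pi.map fun i => (c i).ι.app (k i) :=
  Category.comp_id _

namespace ExactnessConditions

variable (h : ExactnessConditions C κ)

include h

lemma aleph0_le_prime : Cardinal.aleph0 ≤ prime κ := (aleph0_lt_prime h.isRegular).le

variable [Regular C]

/-- Each directedly generated sieve covers a subobject through which it factors. -/
lemma exists_closure {X : C} {T : Sieve X} (hT : IsDirGen (prime κ) T.functor) :
    ∃ (W : C) (m : W ⟶ X), Mono m ∧ (∀ ⦃Y : C⦄ (f : Y ⟶ X), T f → ∃ t, t ≫ m = f) ∧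
      T.pullback m ∈ extremalTopology C W := by
  obtain ⟨K, _, _, hK, D, m, A, e, hm, he, hTe, hg, -⟩ := exists_imageDiagram h.aleph0_le_prime hT
  have := h.hasFilteredColimits K hK
  have := h.commute K hK
  refine ⟨colimit D, colimit.desc D (Cocone.mk X m), mono_desc m hm, fun Y f hf => ?_, ?_⟩
  · obtain ⟨k, s, hs⟩ := hg f hf
    exact ⟨s ≫ e k ≫ colimit.ι D k, by simpa using hs⟩
  · refine mem_extremalTopology_of_isColimit_of_regularEpi (colimit.isColimit D) e he fun k => ?_
    simpa [Sieve.pullback_apply] using hTe k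

/-- If a covering sieve on `X` is generated by maps which factor through a filtered diagram of
subobjects of `X`, then `X` is the colimit of this diagram. -/
lemma isColimit_imageDiagram {K : Type v} [SmallCategory K] [IsFiltered K]
    (hK : HasCardinalLT (Arrow K) (prime κ)) {X : C} {T : Sieve X}
    (hT : T ∈ extremalTopology C X) {D : K ⥤ C}
    (m : D ⟶ (Functor.const K).obj X) {A : K → C} (e : ∀ k, A k ⟶ D.obj k)
    (hm : ∀ k, Mono (m.app k))
    (hg : ∀ ⦃Y : C⦄ (g : Y ⟶ X), T g → ∃ (k : K) (f : Y ⟶ A k), f ≫ e k ≫ m.app k = g) :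
    Nonempty (IsColimit (Cocone.mk X m)) := by
  have := h.hasFilteredColimits K hK
  have := h.commute K hK
  have := mono_desc m hm
  have : IsIso (colimit.desc D (Cocone.mk X m)) :=
    isIso_of_mem_extremalTopology hT _ fun Z g hg' => by
      obtain ⟨k, s, hs⟩ := hg g hg'
      exact ⟨s ≫ e k ≫ colimit.ι D k, by simpa using hs⟩
  have : IsIso ((colimit.isColimit D).desc (Cocone.mk X m)) := this
  exact ⟨(colimit.isColimit D).ofPointIso⟩

/-- Directedly generated covering sieves are effective-epimorphic: a compatible family descends
along the regular epimorphisms to the images of the generators, and then to the colimit of these. -/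
lemma exists_glue {X Y : C} {T : Sieve X} (hT : IsDirGen (prime κ) T.functor)
    (hT' : T ∈ extremalTopology C X) (x : ∀ ⦃Z : C⦄ (g : Z ⟶ X), T g → (Z ⟶ Y))
    (hx : ∀ ⦃Z Z' : C⦄ (g : Z ⟶ X) (hg : T g) (s : Z' ⟶ Z),
      x (s ≫ g) (T.downward_closed hg s) = s ≫ x g hg) :
    ∃ y : X ⟶ Y, ∀ ⦃Z : C⦄ (g : Z ⟶ X) (hg : T g), g ≫ y = x g hg := by
  obtain ⟨K, _, _, hK, D, m, A, e, hm, he, hTe, hg, hs⟩ :=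
    exists_imageDiagram h.aleph0_le_prime hT
  obtain ⟨hc⟩ := h.isColimit_imageDiagram hK hT' m e hm hg
  have hx' : ∀ {Z Z' : C} {g : Z ⟶ X} {g' : Z' ⟶ X} (hg : T g) (hg' : T g') (s : Z' ⟶ Z),
      s ≫ g = g' → s ≫ x g hg = x g' hg' := by
    rintro Z Z' g _ hg hg' s rfl
    exact (hx g hg s).symm
  have hd : ∀ k, ∃ y : D.obj k ⟶ Y, e k ≫ y = x _ (hTe k) := by
    intro k
    have := he k
    refine ⟨IsRegularEpi.desc (e k) (x _ (hTe k)) ?_, IsRegularEpi.fac _ _ _⟩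
    rw [← hx, ← hx]
    congr 1
    rw [← Category.assoc, ← Category.assoc, IsRegularEpi.w]
  choose y hy using hd
  have hnat : ∀ ⦃k l : K⦄ (f : k ⟶ l), D.map f ≫ y l = y k := by
    intro k l f
    obtain ⟨s, hs⟩ := hs f
    have := he k
    rw [← cancel_epi (e k), ← Category.assoc, ← hs, Category.assoc, hy, hy]
    refine hx' _ _ s ?_
    have := m.naturality f
    rw [← Category.assoc, hs, Category.assoc, this]
    simp
  refine ⟨hc.desc (Cocone.mk Y { app := y, naturality := fun k l f => by simp [hnat f] }),
    fun Z g hgT => ?_⟩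
  obtain ⟨k, s, rfl⟩ := hg g hgT
  have : m.app k ≫ hc.desc (Cocone.mk Y { app := y, naturality := fun k l f => by simp [hnat f] })
      = y k := hc.fac _ k
  rw [Category.assoc, Category.assoc, this, hy]
  exact hx' _ _ s rfl

/-- Intersections of fewer than `κ` directedly generated covering sieves are covering: each
is pulled back along a projection to a power of `X`, where the intersection is covering because
regular epimorphisms are stable by products and filtered colimits distribute over products, and is
restricted back along the diagonal. -/
lemma iInf_mem_extremalTopology {I : Type v} (hI : HasCardinalLT I κ) {X : C} (T : I → Sieve X)
    (hT : ∀ i, IsDirGen (prime κ) (T i).functor) (hT' : ∀ i, T i ∈ extremalTopology C X) :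
    (⨅ i, T i) ∈ extremalTopology C X := by
  have := h.hasLimits.hasProductsOfShape hI
  choose K _ _ hK D m A e hm he hTe hg _ using
    fun i => exists_imageDiagram h.aleph0_le_prime (hT i)
  have hc : ∀ i, Nonempty (IsColimit (Cocone.mk X (m i))) := fun i =>
    h.isColimit_imageDiagram (hK i) (hT' i) (m i) (e i) (hm i) (hg i)
  obtain ⟨hc'⟩ := h.distribute I hI K hK D (fun i => Cocone.mk X (m i)) hc
  have hK' := hasCardinalLT_arrow_pi h.isRegular hI K hK
  have := h.hasFilteredColimits (∀ i, K i) hK'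
  have := h.commute (∀ i, K i) hK'
  let S : Sieve (∏ᶜ fun _ : I => X) :=
    { arrows := fun Y f => ∀ i, T i (f ≫ Pi.π _ i)
      downward_closed := fun {Y Z f} hf g i => by
        rw [Category.assoc]
        exact (T i).downward_closed (hf i) g }
  have hS : S ∈ extremalTopology C (∏ᶜ fun _ : I => X) := by
    refine mem_extremalTopology_of_isColimit_of_regularEpi hc'
      (fun k => Limits.Pi.map fun i => e i (k i))
      (fun k => h.products I hI _ _ _ fun i => he i (k i)) fun k i => ?_
    have := (T i).downward_closed (hTe i (k i)) (Pi.π (fun i => A i (k i)) i)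
    have hcomp : ∀ {A B : I → C} (e : ∀ i, A i ⟶ B i) (m : ∀ i, B i ⟶ X),
        (Limits.Pi.map e ≫ Limits.Pi.map m) ≫ Pi.π (fun _ => X) i = Pi.π A i ≫ e i ≫ m i := by
      intros; simp
    rw [← hcomp (fun i => e i (k i)) fun i => (m i).app (k i)] at this
    rw [coconePointwiseProduct_ι_app]
    exact this
  refine (extremalTopology C).superset_covering ?_
    ((extremalTopology C).pullback_stable (Pi.lift fun _ => 𝟙 X) hS)
  intro Y f hf
  rw [iInf_sieve_apply]
  intro i
  simpa using hf i

end ExactnessConditions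

end

section

variable {C : Type u} [Category.{v} C]

/-! ### Local isomorphisms to representables -/

variable {κ : Cardinal.{v}}

/-- The sieve of maps into `U` in the image of a map from a presheaf to the presheaf represented
by `U`. -/
def rangeSieve {P : Cᵒᵖ ⥤ Type v} {U : C} (η : P ⟶ yoneda.obj U) : Sieve U where
  arrows X f := ∃ p : P.obj (op X), η.app _ p = f
  downward_closed := by
    rintro X Y f ⟨p, rfl⟩ g
    exact ⟨P.map g.op p, NatTrans.naturality_apply η g.op p⟩

lemma yoneda_app_map {P : Cᵒᵖ ⥤ Type v} {U : C} (η : P ⟶ yoneda.obj U) {X Y : C} (g : Y ⟶ X)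
    (p : P.obj (op X)) : η.app (op Y) (P.map g.op p) = g ≫ η.app (op X) p :=
  NatTrans.naturality_apply η g.op p

lemma isDirGen_rangeSieve {μ : Cardinal.{v}} {P : Cᵒᵖ ⥤ Type v} (hP : IsDirGen μ P) {U : C}
    (η : P ⟶ yoneda.obj U) : IsDirGen μ (rangeSieve η).functor :=
  hP.of_surjective
    { app := fun X => ↾fun p => ⟨η.app X p, p, rfl⟩
      naturality := fun X Y f => by
        refine ConcreteCategory.hom_ext _ _ fun p => Subtype.ext ?_
        exact NatTrans.naturality_apply η f p }
    (fun X => by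
      rintro ⟨_, p, rfl⟩
      exact ⟨p, rfl⟩)

/-- A map from a presheaf to a representable is a local isomorphism if it is locally surjective and
locally injective for the extremal topology. -/
structure IsLocalIso [HasPullbacks C] {P : Cᵒᵖ ⥤ Type v} {U : C} (η : P ⟶ yoneda.obj U) :
    Prop where
  rangeSieve_mem : rangeSieve η ∈ extremalTopology C U
  eqSieve_mem : ∀ {X : C} (x y : P.obj (op X)), η.app _ x = η.app _ y →
    eqSieve x y ∈ extremalTopology C X

lemma isLocalIso_id [HasPullbacks C] (U : C) : IsLocalIso (𝟙 (yoneda.obj U)) where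
  rangeSieve_mem := (extremalTopology C).superset_covering
    (fun _ f _ => ⟨f, rfl⟩) ((extremalTopology C).top_mem U)
  eqSieve_mem _ _ h := (extremalTopology C).superset_covering
    (fun _ _ _ => congrArg _ h) ((extremalTopology C).top_mem _)

lemma mem_extremalTopology_of_pullback_regularEpi [Regular C] {A X : C} (e : A ⟶ X)
    [IsRegularEpi e] {S : Sieve X} (hS : S.pullback e ∈ extremalTopology C A) :
    S ∈ extremalTopology C X :=
  (extremalTopology C).transitive (S := (extremalTopology C).close S)
    (mem_extremalTopology_of_regularEpi e hS) S fun _ _ hf => hf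

/-- Filtered colimits of local isomorphisms are local isomorphisms. For local injectivity, elements
with equal images in the colimit of the representing objects have, locally, equal images at some
later stage. -/
lemma IsLocalIso.filteredColimit [HasFiniteLimits C] {K : Type v} [SmallCategory K] [IsFiltered K]
    [HasColimitsOfShape K C] [PreservesFiniteLimits (colim : (K ⥤ C) ⥤ C)]
    [∀ k : K, HasColimitsOfShape (Under k) C]
    [∀ k : K, PreservesFiniteLimits (colim : (Under k ⥤ C) ⥤ C)]
    {D : K ⥤ Cᵒᵖ ⥤ Type v} {c : Cocone D} (hc : IsColimit c) {U : K ⥤ C} {c' : Cocone U}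
    (hc' : IsColimit c') (η : D ⟶ U ⋙ yoneda) (hη : ∀ k, IsLocalIso (η.app k))
    (ζ : c.pt ⟶ yoneda.obj c'.pt)
    (hζ : ∀ k, c.ι.app k ≫ ζ = η.app k ≫ yoneda.map (c'.ι.app k)) : IsLocalIso ζ where
  rangeSieve_mem := by
    refine (extremalTopology C).transitive (S := (extremalTopology C).close (rangeSieve ζ))
      (mem_extremalTopology_of_isColimit hc' fun k => ?_) _ fun _ _ hf => hf
    refine (extremalTopology C).superset_covering ?_ (hη k).rangeSieve_mem
    rintro X _ ⟨p, rfl⟩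
    exact ⟨(c.ι.app k).app _ p, ConcreteCategory.congr_hom (NatTrans.congr_app (hζ k) (op X)) p⟩
  eqSieve_mem {X} x y h := by
    obtain ⟨k, x, rfl⟩ := presheaf_colimit_exists hc x
    obtain ⟨l, y, rfl⟩ := presheaf_colimit_exists hc y
    obtain ⟨m, s, t, -⟩ := IsFilteredOrEmpty.cocone_objs k l
    obtain ⟨x', hx'⟩ : ∃ x', (c.ι.app m).app _ x' = (c.ι.app k).app _ x :=
      ⟨(D.map s).app _ x, cocone_app_w c s x⟩
    obtain ⟨y', hy'⟩ : ∃ y', (c.ι.app m).app _ y' = (c.ι.app l).app _ y :=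
      ⟨(D.map t).app _ y, cocone_app_w c t y⟩
    rw [← hx', ← hy'] at h ⊢
    have hζ' : ∀ z : (D.obj m).obj (op X), ζ.app _ ((c.ι.app m).app _ z) =
        (η.app m).app _ z ≫ c'.ι.app m := fun z =>
      ConcreteCategory.congr_hom (NatTrans.congr_app (hζ m) (op X)) z
    rw [hζ', hζ'] at h
    refine (extremalTopology C).transitive (S := (extremalTopology C).close (eqSieve _ _))
      (mem_extremalTopology_of_colimit_eq hc' _ _ h fun l f B t ht => ?_) _ fun _ _ hf => hf
    have hη' : ∀ z : (D.obj m).obj (op X), (η.app l).app _ ((D.map f).app _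
        ((D.obj m).map t.op z)) = t ≫ (η.app m).app _ z ≫ U.map f := fun z => by
      have h1 := ConcreteCategory.congr_hom (NatTrans.congr_app (η.naturality f) (op B))
        ((D.obj m).map t.op z)
      have h2 := yoneda_app_map (η.app m) t z
      refine h1.trans ?_
      change (η.app m).app _ ((D.obj m).map t.op z) ≫ U.map f = _
      rw [h2]
      exact Category.assoc _ _ _
    refine (extremalTopology C).superset_covering ?_ ((hη l).eqSieve_mem
      ((D.map f).app _ ((D.obj m).map t.op x')) ((D.map f).app _ ((D.obj m).map t.op y')) (by
        rw [hη', hη']; exact ht))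
    intro Z g hg
    rw [eqSieve_apply] at hg
    have := congrArg ((c.ι.app l).app _) hg
    rw [cocone_app_map, cocone_app_map, cocone_app_w, cocone_app_w, cocone_app_map,
      cocone_app_map] at this
    change c.pt.map (g ≫ t).op _ = c.pt.map (g ≫ t).op _
    rw [op_comp, Functor.map_comp_apply, Functor.map_comp_apply]
    exact this

namespace ExactnessConditions

variable (h : ExactnessConditions C κ) [Regular C]

include h

/-- A local isomorphism from a directedly generated presheaf is universal among its maps to
representables: local injectivity makes a map `P ⟶ yoneda.obj Y` a compatible family on the range
sieve, which glues. -/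
lemma existsUnique_of_isLocalIso {P : Cᵒᵖ ⥤ Type v} (hP : IsDirGen (prime κ) P) {U : C}
    {η : P ⟶ yoneda.obj U} (hη : IsLocalIso η) {Y : C} (θ : P ⟶ yoneda.obj Y) :
    ∃! f : U ⟶ Y, η ≫ yoneda.map f = θ := by
  have hθ : ∀ {X : C} (p q : P.obj (op X)), η.app _ p = η.app _ q → θ.app _ p = θ.app _ q := by
    intro X p q hpq
    refine hom_ext_of_mem_extremalTopology (hη.eqSieve_mem p q hpq) fun Z t ht => ?_
    rw [← yoneda_app_map, ← yoneda_app_map, (eqSieve_apply _ _ _).1 ht]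
  refine existsUnique_of_exists_of_unique ?_ fun f g hf hg => ?_
  · obtain ⟨y, hy⟩ := h.exists_glue (isDirGen_rangeSieve hP η) hη.rangeSieve_mem
      (fun Z g hg => θ.app (op Z) hg.choose) (fun Z Z' g hg s => by
        rw [← yoneda_app_map]
        refine hθ _ _ ?_
        rw [yoneda_app_map, hg.choose_spec]
        exact ((rangeSieve η).downward_closed hg s).choose_spec)
    refine ⟨y, ?_⟩
    ext X p
    exact (hy _ ⟨p, rfl⟩).trans (hθ _ _ (Exists.choose_spec (p := fun q => η.app X q = _) _))
  · refine hom_ext_of_mem_extremalTopology hη.rangeSieve_mem ?_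
    rintro Z _ ⟨p, rfl⟩
    exact ConcreteCategory.congr_hom (NatTrans.congr_app (hf.trans hg.symm) (op Z)) p

/-- `κ`-limits of local isomorphisms are local isomorphisms. A compatible family of maps lifts
locally to a family of elements, which is locally compatible; both steps intersect fewer than `κ`
covers. -/
lemma isLocalIso_limit {J : Type v} [SmallCategory J] (hJ : HasCardinalLT (Arrow J) κ)
    {D : J ⥤ Cᵒᵖ ⥤ Type v} {c : Cone D} (hc : IsLimit c) {U : J ⥤ C} {c' : Cone U}
    (hc' : IsLimit c') (hD : ∀ j, IsDirPres (prime κ) (D.obj j)) (η : D ⟶ U ⋙ yoneda)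
    (hη : ∀ j, IsLocalIso (η.app j)) (ζ : c.pt ⟶ yoneda.obj c'.pt)
    (hζ : ∀ j, ζ ≫ yoneda.map (c'.π.app j) = c.π.app j ≫ η.app j) : IsLocalIso ζ := by
  have hζ' : ∀ (j) {X : C} (x : c.pt.obj (op X)),
      ζ.app _ x ≫ c'.π.app j = (η.app j).app _ ((c.π.app j).app _ x) := fun j X x =>
    ConcreteCategory.congr_hom (NatTrans.congr_app (hζ j) (op X)) x
  have hη' : ∀ {i j : J} (f : i ⟶ j) {X : C} (x : (D.obj i).obj (op X)),
      (η.app j).app _ ((D.map f).app _ x) = (η.app i).app _ x ≫ U.map f := fun f X x =>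
    ConcreteCategory.congr_hom (NatTrans.congr_app (η.naturality f) (op X)) x
  constructor
  · have hT : (⨅ j, (rangeSieve (η.app j)).pullback (c'.π.app j)) ∈ extremalTopology C c'.pt :=
      h.iInf_mem_extremalTopology (hasCardinalLT_of_arrow hJ) _
        (fun j => isDirGen_pullback (isDirGen_rangeSieve (hD j).isDirGen _) _)
        (fun j => (extremalTopology C).pullback_stable _ (hη j).rangeSieve_mem)
    refine (extremalTopology C).transitive hT _ fun X t ht => ?_
    rw [iInf_sieve_apply] at ht
    choose p hp using ht
    have hcompat : compatSieve D p ∈ extremalTopology C X :=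
      h.iInf_mem_extremalTopology hJ _ (fun f => (hD _).isDirGen_eqSieve _ _) fun f =>
        (hη _).eqSieve_mem _ _ (by
          rw [hη', hp, hp, Category.assoc, ← c'.w f.hom])
    refine (extremalTopology C).superset_covering (fun Y s hs => ?_) hcompat
    obtain ⟨y, hy⟩ := exists_of_compatSieve hc p s hs
    refine ⟨y, hc'.hom_ext fun j => ?_⟩
    rw [hζ', hy, Category.assoc, ← hp]
    exact yoneda_app_map (η.app j) s (p j)
  · intro X x y hxy
    rw [eqSieve_eq_iInf hc]
    refine h.iInf_mem_extremalTopology (hasCardinalLT_of_arrow hJ) _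
      (fun j => (hD j).isDirGen_eqSieve _ _) fun j => (hη j).eqSieve_mem _ _ ?_
    rw [← hζ', ← hζ', hxy]

end ExactnessConditions

end

section

variable {C : Type u} [Category.{v} C]

variable {κ : Cardinal.{v}}

/-! ### Reflexive coequalisers of local isomorphisms -/

section

variable [HasBinaryProducts C] {Q R : Cᵒᵖ ⥤ Type v} {Y : C}

/-- Given maps `η : Q ⟶ yoneda.obj Y` and `π : Q ⟶ R`, the sieve of maps into `Y ⨯ Y` whose two
components are the images under `η` of elements of `Q` that are identified in `R`. -/
def identSieve (η : Q ⟶ yoneda.obj Y) (π : Q ⟶ R) : Sieve (Y ⨯ Y) where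
  arrows X h := ∃ x y : Q.obj (op X), η.app _ x = h ≫ prod.fst ∧ η.app _ y = h ≫ prod.snd ∧
    π.app _ x = π.app _ y
  downward_closed := by
    rintro X Z h ⟨x, y, hx, hy, hxy⟩ t
    refine ⟨Q.map t.op x, Q.map t.op y, ?_, ?_, ?_⟩
    · rw [yoneda_app_map, hx, Category.assoc]
    · rw [yoneda_app_map, hy, Category.assoc]
    · rw [NatTrans.naturality_apply, NatTrans.naturality_apply, hxy]

lemma pullback_identSieve_apply (η : Q ⟶ yoneda.obj Y) (π : Q ⟶ R) {X Z : C} (x y : X ⟶ Y)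
    (t : Z ⟶ X) : (identSieve η π).pullback (prod.lift x y) t ↔
      ∃ x' y' : Q.obj (op Z), η.app _ x' = t ≫ x ∧ η.app _ y' = t ≫ y ∧
        π.app _ x' = π.app _ y' := by
  change (∃ x' y' : Q.obj (op Z), η.app _ x' = (t ≫ prod.lift x y) ≫ prod.fst ∧
    η.app _ y' = (t ≫ prod.lift x y) ≫ prod.snd ∧ π.app _ x' = π.app _ y') ↔ _
  simp only [Category.assoc, prod.lift_fst, prod.lift_snd]

end

lemma isDirGen_identSieve [HasFiniteLimits C] (hκ : κ.IsRegular) (hC : HasLimitsLT C κ)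
    {Q R : Cᵒᵖ ⥤ Type v} {Y : C} (η : Q ⟶ yoneda.obj Y) (π : Q ⟶ R)
    (hQ : IsDirGen (prime κ) Q) (hR : IsDirPres (prime κ) R) :
    IsDirGen (prime κ) (identSieve η π).functor := by
  have hY := isDirPres_yoneda (aleph0_lt_prime hκ).le Y
  refine isDirGen_exists (isRegular_prime hκ)
    (isDirGen_piPresheaf hκ hC (hasCardinalLT_of_finite (ULift.{v} Bool) _ hκ.aleph0_le)
      (fun _ => Q) fun _ => hQ) _
    (fun {Z} h w => eqSieve (P := yoneda.obj Y) (η.app _ (w ⟨true⟩)) (h ≫ prod.fst) ⊓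
      (eqSieve (P := yoneda.obj Y) (η.app _ (w ⟨false⟩)) (h ≫ prod.snd) ⊓
        eqSieve (π.app _ (w ⟨true⟩)) (π.app _ (w ⟨false⟩))))
    (fun h w => isDirGen_inf hκ hC (hY.isDirGen_eqSieve _ _)
      (isDirGen_inf hκ hC (hY.isDirGen_eqSieve _ _) (hR.isDirGen_eqSieve _ _)))
    (fun {Z Z'} h w t => ?_) (fun {Z} h => ⟨?_, ?_⟩)
  · simp only [Sieve.inter_apply, eqSieve_apply]
    simp only [yoneda_obj_obj, yoneda_obj_map, Quiver.Hom.unop_op, TypeCat.hom_ofHom,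
      TypeCat.Fun.coe_mk, op_id, unop_id, Category.id_comp, TypeCat.ofHom_apply, Category.assoc,
      CategoryTheory.Functor.map_id, id_apply]
    change _ ↔ η.app _ (Q.map t.op (w ⟨true⟩)) = t ≫ h ≫ prod.fst ∧
      η.app _ (Q.map t.op (w ⟨false⟩)) = t ≫ h ≫ prod.snd ∧
        π.app _ (Q.map t.op (w ⟨true⟩)) = π.app _ (Q.map t.op (w ⟨false⟩))
    rw [yoneda_app_map, yoneda_app_map, NatTrans.naturality_apply, NatTrans.naturality_apply]
  · rintro ⟨x, y, hx, hy, hxy⟩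
    refine ⟨fun b => cond b.down x y, ?_⟩
    simp only [Sieve.inter_apply, eqSieve_apply, cond_true, cond_false, hx, hy, hxy, and_self]
  · rintro ⟨w, hw⟩
    refine ⟨w ⟨true⟩, w ⟨false⟩, ?_⟩
    simpa [Sieve.inter_apply, eqSieve_apply] using hw

namespace ExactnessConditions

variable (h : ExactnessConditions C κ) [Regular C]

include h

/-- The coequaliser of a reflexive pair of local isomorphisms is a local isomorphism. The relation
on `Y` induced by the coequaliser of presheaves is locally that of a subobject of `Y ⨯ Y`, which is
an equivalence relation; as it is effective, it contains the kernel pair of the coequaliser of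
`d₀` and `d₁`. -/
lemma isLocalIso_reflexiveCoequalizer {P Q : Cᵒᵖ ⥤ Type v} {f g : P ⟶ Q}
    (hfg : IsReflexivePair f g) {c : Cofork f g} (hc : IsColimit c)
    (hP : IsDirPres (prime κ) P) (hQ : IsDirPres (prime κ) Q) {U Y : C} {d₀ d₁ : U ⟶ Y}
    {c' : Cofork d₀ d₁} (hc' : IsColimit c') {ηP : P ⟶ yoneda.obj U} {ηQ : Q ⟶ yoneda.obj Y}
    (hηP : IsLocalIso ηP) (hηQ : IsLocalIso ηQ) (hf : f ≫ ηQ = ηP ≫ yoneda.map d₀)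
    (hg : g ≫ ηQ = ηP ≫ yoneda.map d₁) (ζ : c.pt ⟶ yoneda.obj c'.pt)
    (hζ : c.π ≫ ζ = ηQ ≫ yoneda.map c'.π) : IsLocalIso ζ := by
  have hR := IsDirPres.reflexiveCoequalizer h.isRegular h.hasLimits hfg hc hP hQ
  obtain ⟨W, m, hm, hmT, hm'⟩ := h.exists_closure
    (isDirGen_identSieve h.isRegular h.hasLimits ηQ c.π hQ.isDirGen hR)
  have key : ∀ {X : C} (x y : X ⟶ Y), (∃ r : X ⟶ W, r ≫ m ≫ prod.fst = x ∧
      r ≫ m ≫ prod.snd = y) ↔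
        (identSieve ηQ c.π).pullback (prod.lift x y) ∈ extremalTopology C X := by
    intro X x y
    rw [← factors_iff_mem_extremalTopology m hmT hm']
    refine exists_congr fun r => ⟨fun hr => ?_, fun hr => ?_⟩
    · refine Limits.prod.hom_ext ?_ ?_
      · rw [Category.assoc, hr.1, prod.lift_fst]
      · rw [Category.assoc, hr.2, prod.lift_snd]
    · rw [← Category.assoc, ← Category.assoc, hr, prod.lift_fst, prod.lift_snd]
      exact ⟨rfl, rfl⟩
  have hζ' : ∀ {X : C} (x : Q.obj (op X)), ζ.app _ (c.π.app _ x) = ηQ.app _ x ≫ c'.π := fun x =>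
    ConcreteCategory.congr_hom (NatTrans.congr_app hζ _) x
  have hW : IsEquivalenceRelation (m ≫ prod.fst) (m ≫ prod.snd) := by
    refine ⟨fun X r s h₁ h₂ => ?_, fun X => ?_⟩
    · rw [← cancel_mono m]
      ext
      · simpa using h₁
      · simpa using h₂
    · simp only [key]
      refine ⟨fun x => ?_, fun {x y} hxy => ?_, fun {x y z} hxy hyz => ?_⟩
      · refine (extremalTopology C).superset_covering ?_
          ((extremalTopology C).pullback_stable x hηQ.rangeSieve_mem)
        rintro Z t ⟨p, hp⟩
        exact (pullback_identSieve_apply _ _ _ _ _).2 ⟨p, p, hp, hp, rfl⟩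
      · refine (extremalTopology C).superset_covering ?_ hxy
        intro Z t ht
        obtain ⟨x', y', hx, hy, e⟩ := (pullback_identSieve_apply _ _ _ _ _).1 ht
        exact (pullback_identSieve_apply _ _ _ _ _).2 ⟨y', x', hy, hx, e.symm⟩
      · refine (extremalTopology C).transitive
          ((extremalTopology C).intersection_covering hxy hyz) _ ?_
        rintro Z t ⟨h₁, h₂⟩
        obtain ⟨x₁, y₁, hx₁, hy₁, e₁⟩ := (pullback_identSieve_apply _ _ _ _ _).1 h₁
        obtain ⟨y₂, z₂, hy₂, hz₂, e₂⟩ := (pullback_identSieve_apply _ _ _ _ _).1 h₂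
        refine (extremalTopology C).superset_covering ?_
          (hηQ.eqSieve_mem y₁ y₂ (hy₁.trans hy₂.symm))
        intro Z' s hs
        refine (pullback_identSieve_apply _ _ _ _ _).2 ⟨Q.map s.op x₁, Q.map s.op z₂, ?_, ?_, ?_⟩
        · rw [yoneda_app_map, hx₁, Category.assoc]
        · rw [yoneda_app_map, hz₂, Category.assoc]
        · rw [NatTrans.naturality_apply, e₁, ← NatTrans.naturality_apply,
            (eqSieve_apply _ _ _).1 hs, NatTrans.naturality_apply, e₂,
            ← NatTrans.naturality_apply]
  obtain ⟨Z, k, hk⟩ := h.isBarrExact.2 _ _ hW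
  obtain ⟨k', hk'⟩ : ∃ k', c'.π ≫ k' = k := by
    obtain ⟨r, hr, hr'⟩ := (key d₀ d₁).2 <| by
      refine (extremalTopology C).superset_covering ?_ hηP.rangeSieve_mem
      rintro X _ ⟨p, rfl⟩
      exact (pullback_identSieve_apply _ _ _ _ _).2 ⟨f.app _ p, g.app _ p,
        ConcreteCategory.congr_hom (NatTrans.congr_app hf _) p,
        ConcreteCategory.congr_hom (NatTrans.congr_app hg _) p,
        ConcreteCategory.congr_hom (NatTrans.congr_app c.condition _) p⟩
    refine ⟨Cofork.IsColimit.desc hc' k ?_, Cofork.IsColimit.π_desc' hc' k _⟩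
    rw [← hr, ← hr', Category.assoc, Category.assoc r, hk.w]
  have : IsRegularEpi c'.π := ⟨⟨⟨U, d₀, d₁, c'.condition,
    hc'.ofIsoColimit (Cofork.isoCoforkOfπ c')⟩⟩⟩
  constructor
  · refine mem_extremalTopology_of_pullback_regularEpi c'.π
      ((extremalTopology C).superset_covering ?_ hηQ.rangeSieve_mem)
    rintro X _ ⟨p, rfl⟩
    exact ⟨c.π.app _ p, hζ' p⟩
  · intro X x y hxy
    obtain ⟨x, rfl⟩ := presheaf_coequalizer_exists hc x
    obtain ⟨y, rfl⟩ := presheaf_coequalizer_exists hc y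
    rw [hζ', hζ'] at hxy
    have hxy' : ηQ.app _ x ≫ k = ηQ.app _ y ≫ k := by
      rw [← hk', ← Category.assoc, hxy, Category.assoc]
    refine (extremalTopology C).transitive ((key _ _).1 ⟨hk.lift _ _ hxy', hk.lift_fst _ _ _,
      hk.lift_snd _ _ _⟩) _ fun Z t ht => ?_
    obtain ⟨x', y', hx, hy, e⟩ := (pullback_identSieve_apply _ _ _ _ _).1 ht
    refine (extremalTopology C).superset_covering ?_ ((extremalTopology C).intersection_covering
      (hηQ.eqSieve_mem x' (Q.map t.op x) (hx.trans (yoneda_app_map _ _ _).symm))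
      (hηQ.eqSieve_mem y' (Q.map t.op y) (hy.trans (yoneda_app_map _ _ _).symm)))
    rintro Z' s ⟨h₁, h₂⟩
    rw [eqSieve_apply] at h₁ h₂
    change c.pt.map (s ≫ t).op _ = c.pt.map (s ≫ t).op _
    rw [← NatTrans.naturality_apply, ← NatTrans.naturality_apply, op_comp,
      Functor.map_comp_apply, Functor.map_comp_apply, ← h₁, ← h₂, NatTrans.naturality_apply,
      NatTrans.naturality_apply, e]

end ExactnessConditions

end

section

variable {C : Type u} [Category.{v} C]

variable {κ : Cardinal.{v}}

/-! ### The left adjoint -/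

lemma isClosedUnderLimitsOfShape_closure {J : Type v} [SmallCategory J]
    (hJ : HasCardinalLT (Arrow J) κ) : (closure C κ).IsClosedUnderLimitsOfShape J where
  limitsOfShape_le := by
    rintro X ⟨p⟩
    exact closure.limit hJ p.diag _ p.isLimit p.prop_diag_obj

lemma isClosedUnderColimitsOfShape_closure {K : Type v} [SmallCategory K] [hK : IsFiltered K]
    (hK' : HasCardinalLT (Arrow K) (prime κ)) : (closure C κ).IsClosedUnderColimitsOfShape K where
  colimitsOfShape_le := by
    rintro X ⟨p⟩
    exact closure.filteredColimit hK hK' p.diag _ p.isColimit p.prop_diag_obj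

namespace ExactnessConditions

variable (h : ExactnessConditions C κ) [Regular C]

include h

/-- Local isomorphisms from the objects of a diagram to representables assemble into a natural
transformation, by their universal property. -/
lemma exists_diagram {J : Type v} [SmallCategory J] {D : J ⥤ Cᵒᵖ ⥤ Type v}
    (hD : ∀ j, IsDirPres (prime κ) (D.obj j))
    (hD' : ∀ j, ∃ (U : C) (η : D.obj j ⟶ yoneda.obj U), IsLocalIso η) :
    ∃ (U : J ⥤ C) (η : D ⟶ U ⋙ yoneda), ∀ j, IsLocalIso (η.app j) := by
  choose U η hη using hD'
  have hu := fun (i j : J) (f : i ⟶ j) =>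
    h.existsUnique_of_isLocalIso (hD i).isDirGen (hη i) (D.map f ≫ η j)
  choose m hm hm' using hu
  exact ⟨
    { obj := U
      map := fun {i j} f => m i j f
      map_id := fun j => (hm' j j _ _ (by simp)).symm
      map_comp := fun {i j k} f g => (hm' i k _ _ (by
        simp only [Functor.map_comp, Category.assoc, ← hm j k]
        rw [← Category.assoc, hm, Category.assoc])).symm },
    { app := η
      naturality := fun i j f => (hm i j f).symm }, hη⟩

/-- Each object of `S C κ` is directedly presented and admits a local isomorphism to a
representable. -/
lemma isDirPres_and_exists_isLocalIso (hC : HasReflexiveCoequalizers C) {P : Cᵒᵖ ⥤ Type v}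
    (hP : closure C κ P) :
    IsDirPres (prime κ) P ∧ ∃ (U : C) (η : P ⟶ yoneda.obj U), IsLocalIso η := by
  induction hP with
  | representable X => exact ⟨isDirPres_yoneda h.aleph0_le_prime X, X, 𝟙 _, isLocalIso_id X⟩
  | @limit J _ hJ D c hc _ ih =>
    have := h.hasLimits J hJ
    refine ⟨.limit h.isRegular h.hasLimits hJ hc fun j => (ih j).1, ?_⟩
    obtain ⟨U, η, hη⟩ := h.exists_diagram (fun j => (ih j).1) (fun j => (ih j).2)
    let hU := isLimitOfPreserves yoneda (limit.isLimit U)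
    exact ⟨limit U, hU.lift ((Cone.postcompose η).obj c), h.isLocalIso_limit hJ hc
      (limit.isLimit U) (fun j => (ih j).1) η hη _ fun j => hU.fac _ j⟩
  | @reflexiveCoequalizer P Q f g hfg c hc _ _ ihP ihQ =>
    refine ⟨.reflexiveCoequalizer h.isRegular h.hasLimits hfg hc ihP.1 ihQ.1, ?_⟩
    obtain ⟨hP, U, ηP, hηP⟩ := ihP
    obtain ⟨hQ, Y, ηQ, hηQ⟩ := ihQ
    obtain ⟨d₀, hd₀, -⟩ := h.existsUnique_of_isLocalIso hP.isDirGen hηP (f ≫ ηQ)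
    obtain ⟨d₁, hd₁, -⟩ := h.existsUnique_of_isLocalIso hP.isDirGen hηP (g ≫ ηQ)
    obtain ⟨s, hs, hs'⟩ := hfg.common_section
    obtain ⟨t, ht, -⟩ := h.existsUnique_of_isLocalIso hQ.isDirGen hηQ (s ≫ ηP)
    have hY : ∀ {f g : Y ⟶ Y}, ηQ ≫ yoneda.map f = ηQ → ηQ ≫ yoneda.map g = ηQ → f = g :=
      (h.existsUnique_of_isLocalIso hQ.isDirGen hηQ ηQ).unique
    have : IsReflexivePair d₀ d₁ := .mk' t
      (hY (by rw [Functor.map_comp, ← Category.assoc, ht, Category.assoc, hd₀, ← Category.assoc, hs,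
        Category.id_comp]) (by simp))
      (hY (by rw [Functor.map_comp, ← Category.assoc, ht, Category.assoc, hd₁, ← Category.assoc,
        hs', Category.id_comp]) (by simp))
    have := hC.has_coeq d₀ d₁
    refine ⟨coequalizer d₀ d₁, Cofork.IsColimit.desc hc (ηQ ≫ yoneda.map (coequalizer.π d₀ d₁)) ?_,
      h.isLocalIso_reflexiveCoequalizer hfg hc hP hQ (coequalizerIsCoequalizer d₀ d₁) hηP hηQ
        hd₀.symm hd₁.symm _ (Cofork.IsColimit.π_desc' hc _ _)⟩
    rw [← Category.assoc, ← Category.assoc, ← hd₀, ← hd₁, Category.assoc, Category.assoc,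
      ← Functor.map_comp, ← Functor.map_comp, coequalizer.condition]
  | @filteredColimit K _ hK hK' D c hc _ ih =>
    refine ⟨.filteredColimit (isRegular_prime h.isRegular) hK' hc fun k => (ih k).1, ?_⟩
    obtain ⟨U, η, hη⟩ := h.exists_diagram (fun j => (ih j).1) (fun j => (ih j).2)
    have := h.hasFilteredColimits K hK'
    have := h.commute K hK'
    have hU := fun k : K => hasCardinalLT_arrow_under h.aleph0_le_prime hK' k
    have := fun k : K => h.hasFilteredColimits (Under k) (hU k)
    have := fun k : K => h.commute (Under k) (hU k)
    exact ⟨colimit U, hc.desc ((Cocone.precompose η).obj (yoneda.mapCocone (colimit.cocone U))),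
      .filteredColimit hc (colimit.isColimit U) η hη _ fun k => hc.fac _ k⟩

/-- The exactness conditions are sufficient. The units of the left adjoint are local isomorphisms;
in a `κ`-limit of objects of `S C κ` the unit and the limit of the units are both local isomorphisms
to representables, so agree by the universal property. -/
theorem isAlgebraicallyExact (hC : HasReflexiveCoequalizers C) : IsAlgebraicallyExact C κ := by
  choose hS U η hη using fun P : S C κ =>
    h.isDirPres_and_exists_isLocalIso hC P.property
  have hu := fun P : S C κ => fun {Y : C} => h.existsUnique_of_isLocalIso (hS P).isDirGen (hη P)
    (Y := Y)
  let e : ∀ (P : S C κ) (Y : C), (U P ⟶ Y) ≃ (P ⟶ (V C κ).obj Y) := fun P Y =>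
    Equiv.ofBijective (fun f => ObjectProperty.homMk (η P ≫ yoneda.map f)) (by
      constructor
      · intro f g hfg
        exact (hu P _).unique (congrArg (fun t => t.hom) hfg) rfl
      · intro θ
        obtain ⟨f, hf, -⟩ := hu P θ.hom
        exact ⟨f, ObjectProperty.hom_ext _ hf⟩)
  have he : ∀ (P : S C κ) (Y Y' : C) (g : Y ⟶ Y') (f : U P ⟶ Y),
      e P Y' (f ≫ g) = e P Y f ≫ (V C κ).map g := fun P Y Y' g f => by
    refine ObjectProperty.hom_ext _ ?_
    change η P ≫ yoneda.map (f ≫ g) = (η P ≫ yoneda.map f) ≫ yoneda.map g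
    rw [Functor.map_comp, Category.assoc]
  let L := Adjunction.leftAdjointOfEquiv e he
  let adj : L ⊣ V C κ := Adjunction.adjunctionOfEquivLeft e he
  have hunit : ∀ P, (adj.unit.app P).hom = η P := fun P => by
    change η P ≫ yoneda.map (𝟙 _) = η P
    simp
  refine ⟨L, ⟨adj⟩, fun J _ hJ => ⟨fun {D} => ⟨fun {c} hc => ?_⟩⟩⟩
  have := h.hasLimits J hJ
  have := isClosedUnderLimitsOfShape_closure (C := C) hJ
  let hc' := isLimitOfPreserves (closure C κ).ι hc
  let hl := limit.isLimit (D ⋙ L)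
  let hl' := isLimitOfPreserves yoneda hl
  let η' : D ⋙ (closure C κ).ι ⟶ (D ⋙ L) ⋙ yoneda :=
    { app := fun j => η (D.obj j)
      naturality := fun i j f => by
        have := congrArg (fun t => t.hom) (adj.unit.naturality (D.map f))
        have h2 : (D.map f).hom ≫ (adj.unit.app (D.obj j)).hom =
          (adj.unit.app (D.obj i)).hom ≫ yoneda.map (L.map (D.map f)) := this
        rw [hunit, hunit] at h2
        exact h2 }
  let f : L.obj c.pt ⟶ limit (D ⋙ L) := hl.lift (L.mapCone c)
  let ζ : c.pt.obj ⟶ yoneda.obj (limit (D ⋙ L)) := η c.pt ≫ yoneda.map f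
  have hζ : IsLocalIso ζ := by
    refine h.isLocalIso_limit hJ hc' hl (fun j => hS (D.obj j)) η' (fun j => hη _) ζ fun j => ?_
    have h1 := congrArg (fun t => t.hom) (adj.unit.naturality (c.π.app j))
    have h2 : (c.π.app j).hom ≫ (adj.unit.app (D.obj j)).hom =
      (adj.unit.app c.pt).hom ≫ yoneda.map (L.map (c.π.app j)) := h1
    rw [hunit, hunit] at h2
    refine Eq.trans ?_ h2.symm
    rw [Category.assoc, ← Functor.map_comp, hl.fac]
    rfl
  obtain ⟨g, hg, -⟩ := h.existsUnique_of_isLocalIso (hS c.pt).isDirGen hζ (η c.pt)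
  have hid : ∀ {Y : C} (θ : c.pt.obj ⟶ yoneda.obj Y), θ ≫ yoneda.map (𝟙 Y) = θ := by simp
  have : IsIso f := by
    refine ⟨g, (hu c.pt (η c.pt)).unique ?_ (hid _),
      (h.existsUnique_of_isLocalIso (hS c.pt).isDirGen hζ ζ).unique ?_ (hid _)⟩
    · rw [Functor.map_comp, ← Category.assoc, hg]
    · rw [Functor.map_comp, ← Category.assoc, hg]
  exact ⟨IsLimit.ofPointIso (r := limit.cone (D ⋙ L)) hl⟩

end ExactnessConditions

end

section

variable {C : Type u} [Category.{v} C]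

variable {κ : Cardinal.{v}}

/-! ### Transfer of exactness along the left adjoint -/

lemma hasFiniteLimits_of_hasLimitsOfShape {D : Type*} [Category* D] (hκ : Cardinal.aleph0 ≤ κ)
    (h : ∀ (J : Type v) [SmallCategory J], HasCardinalLT (Arrow J) κ → HasLimitsOfShape J D) :
    HasFiniteLimits D :=
  hasFiniteLimits_of_hasFiniteLimits_of_size.{v} D fun J _ _ =>
    h J (hasCardinalLT_of_finite _ _ hκ)

lemma preservesFiniteLimits_of_preservesLimitsOfShape {D E : Type*} [Category* D] [Category* E]
    (F : D ⥤ E) (hκ : Cardinal.aleph0 ≤ κ)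
    (h : ∀ (J : Type v) [SmallCategory J], HasCardinalLT (Arrow J) κ →
      PreservesLimitsOfShape J F) : PreservesFiniteLimits F :=
  preservesFiniteLimits_of_preservesFiniteLimitsOfSize.{v} F fun J _ _ =>
    h J (hasCardinalLT_of_finite _ _ hκ)

lemma hasLimitsOfShape_S {J : Type v} [SmallCategory J] (hJ : HasCardinalLT (Arrow J) κ) :
    HasLimitsOfShape J (S C κ) := by
  have := isClosedUnderLimitsOfShape_closure (C := C) hJ
  infer_instance

lemma preservesLimitsOfShape_ι {J : Type v} [SmallCategory J] (hJ : HasCardinalLT (Arrow J) κ) :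
    PreservesLimitsOfShape J (closure C κ).ι := by
  have := isClosedUnderLimitsOfShape_closure (C := C) hJ
  infer_instance

instance : (V C κ).Full :=
  inferInstanceAs ((closure C κ).lift yoneda closure.representable).Full

instance : (V C κ).Faithful :=
  inferInstanceAs ((closure C κ).lift yoneda closure.representable).Faithful

/-- A pointwise surjective map in `S C κ` is a regular epimorphism there: its kernel pair is
computed in presheaves. -/
lemma isRegularEpi_of_surjective (hκ : Cardinal.aleph0 ≤ κ) {P Q : S C κ} (φ : P ⟶ Q)
    (hφ : ∀ X, Function.Surjective (φ.hom.app X)) : IsRegularEpi φ := by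
  have : HasFiniteLimits (S C κ) := hasFiniteLimits_of_hasLimitsOfShape hκ
    fun J _ hJ => hasLimitsOfShape_S hJ
  have : PreservesFiniteLimits (closure C κ).ι :=
    preservesFiniteLimits_of_preservesLimitsOfShape _ hκ fun J _ hJ => preservesLimitsOfShape_ι hJ
  have : Epi φ := by
    have : Epi φ.hom := by
      have : ∀ X, Epi (φ.hom.app X) := fun X => (epi_iff_surjective _).2 (hφ X)
      exact NatTrans.epi_of_epi_app _
    exact (closure C κ).ι.epi_of_epi_map this
  refine IsRegularEpi.of_epi_of_exists fun {Z} k hk => ?_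
  have key : ∀ (X) (x y : P.obj.obj X), φ.hom.app X x = φ.hom.app X y →
      k.hom.app X x = k.hom.app X y := fun X x y hxy => by
    have sq := ((IsPullback.of_hasPullback φ φ).map (closure C κ).ι).map
      ((evaluation _ _).obj X)
    obtain ⟨z, rfl, rfl⟩ := Types.exists_of_isPullback sq x y hxy
    exact ConcreteCategory.congr_hom (NatTrans.congr_app (congrArg (fun t => t.hom) hk) X) z
  choose s hs using hφ
  refine ⟨ObjectProperty.homMk
    { app := fun X => ↾fun q => k.hom.app X (s X q)
      naturality := fun X Y f => ConcreteCategory.hom_ext _ _ fun q => ?_ }, ?_⟩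
  · refine Eq.trans ?_ (NatTrans.naturality_apply k.hom f (s X q))
    refine key _ _ _ ?_
    rw [hs, NatTrans.naturality_apply, hs]
    rfl
  · refine ObjectProperty.hom_ext _ (NatTrans.ext (funext fun X =>
      ConcreteCategory.hom_ext _ _ fun p => ?_))
    exact key _ _ _ (hs _ _)

section Adjoint

variable {L : S C κ ⥤ C} (adj : L ⊣ V C κ)

include adj

lemma isRegularEpi_map {P Q : S C κ} (φ : P ⟶ Q) [IsRegularEpi φ] : IsRegularEpi (L.map φ) := by
  have := adj.leftAdjoint_preservesColimits
  exact ⟨⟨_, _, _, _, isColimitCoforkMapOfIsColimit L _ (IsRegularEpi.isColimit φ)⟩⟩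

/-- As `V` is fully faithful, the counit of `L ⊣ V` is an isomorphism. -/
lemma isEquivalence_V_comp : (V C κ ⋙ L).IsEquivalence :=
  Functor.isEquivalence_of_iso (asIso adj.counit).symm

lemma isRegularEpi_of_map {A B : C} (e : A ⟶ B) (he : IsRegularEpi (L.map ((V C κ).map e))) :
    IsRegularEpi e :=
  ((MorphismProperty.regularEpi C).arrow_mk_iso_iff
    (Arrow.isoMk (asIso (adj.counit.app A)) (asIso (adj.counit.app B)))).1 he

/-- A regular epimorphism of `C` factors in `S C κ` as a surjection followed by a map inverted
by `L`. -/
lemma exists_factorisation {A B : C} (e : A ⟶ B) [IsRegularEpi e] [HasPullback e e] :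
    ∃ (Q : S C κ) (q : (V C κ).obj A ⟶ Q) (i : Q ⟶ (V C κ).obj B),
      q ≫ i = (V C κ).map e ∧ (∀ X, Function.Surjective (q.hom.app X)) ∧ IsIso (L.map i) := by
  have hk : IsKernelPair e (pullback.fst e e) (pullback.snd e e) := .of_hasPullback e
  let a := yoneda.map (pullback.fst e e)
  let b := yoneda.map (pullback.snd e e)
  have hab : IsReflexivePair a b := .mk' (yoneda.map (pullback.lift (𝟙 A) (𝟙 A) rfl))
    (by rw [← Functor.map_comp, pullback.lift_fst]; simp)
    (by rw [← Functor.map_comp, pullback.lift_snd]; simp)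
  have hc := coequalizerIsCoequalizer a b
  let Q : S C κ := ⟨coequalizer a b, closure.reflexiveCoequalizer a b hab
    (Cofork.ofπ (coequalizer.π a b) (coequalizer.condition a b)) hc
    (closure.representable _) (closure.representable _)⟩
  let q : (V C κ).obj A ⟶ Q := ObjectProperty.homMk (coequalizer.π a b)
  have he : a ≫ yoneda.map e = b ≫ yoneda.map e := by
    rw [← Functor.map_comp, ← Functor.map_comp, pullback.condition]
  let i : Q ⟶ (V C κ).obj B := ObjectProperty.homMk (coequalizer.desc (yoneda.map e) he)
  have hqi : q ≫ i = (V C κ).map e :=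
    ObjectProperty.hom_ext _ (coequalizer.π_desc (yoneda.map e) _)
  have hq : ∀ X, Function.Surjective (q.hom.app X) := fun X x => presheaf_coequalizer_exists hc x
  refine ⟨Q, q, i, hqi, hq, ?_⟩
  have hw : (V C κ).map (pullback.fst e e) ≫ q = (V C κ).map (pullback.snd e e) ≫ q :=
    ObjectProperty.hom_ext _ (coequalizer.condition a b)
  have hq' : Epi q := by
    have : Epi q.hom := inferInstanceAs (Epi (coequalizer.π a b))
    exact (closure C κ).ι.epi_of_epi_map this
  have := adj.leftAdjoint_preservesColimits
  have := isEquivalence_V_comp adj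
  have he : Epi (L.map ((V C κ).map e)) := inferInstanceAs (Epi ((V C κ ⋙ L).map e))
  -- Since `e` is the coequaliser of its kernel pair, `L.map q` factors through it, which gives the
  -- inverse of `L.map i`.
  obtain ⟨g, hg⟩ : ∃ g : B ⟶ L.obj Q, e ≫ g = inv (adj.counit.app A) ≫ L.map q := by
    refine ⟨Cofork.IsColimit.desc hk.toCoequalizer' (inv (adj.counit.app A) ≫ L.map q) ?_,
      Cofork.IsColimit.π_desc' hk.toCoequalizer' _ _⟩
    have := congrArg L.map hw
    rw [L.map_comp, L.map_comp] at this
    have h1 : ∀ {X Y : C} (t : X ⟶ Y), t ≫ inv (adj.counit.app Y) =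
        inv (adj.counit.app X) ≫ L.map ((V C κ).map t) := fun t => by
      rw [IsIso.comp_inv_eq, Category.assoc, IsIso.eq_inv_comp]
      exact (adj.counit.naturality t).symm
    rw [← Category.assoc, ← Category.assoc, h1, h1, Category.assoc, Category.assoc, this]
  have h2 : L.map ((V C κ).map e) ≫ adj.counit.app B ≫ g = L.map q := by
    have := adj.counit.naturality e
    dsimp only [Functor.comp_map, Functor.id_map, Functor.comp_obj, Functor.id_obj] at this
    rw [← Category.assoc, this, Category.assoc, hg, IsIso.hom_inv_id_assoc]
  refine ⟨adj.counit.app B ≫ g, ?_, ?_⟩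
  · rw [← cancel_epi (L.map q), ← Category.assoc, ← L.map_comp, hqi, h2, Category.comp_id]
  · rw [← cancel_epi (L.map ((V C κ).map e)), ← Category.assoc, h2, ← L.map_comp, hqi]
    exact (Category.comp_id _).symm

/-- Stability of regular epimorphisms under base change: pull back in `S C κ` the factorisation of
`exists_factorisation`, and apply `L`. -/
lemma isRegularEpi_of_isPullback [PreservesFiniteLimits L] (hκ : Cardinal.aleph0 ≤ κ)
    {A B A' B' : C} {e : A ⟶ B} {e' : A' ⟶ B'} {f : A' ⟶ A} {g : B' ⟶ B}
    [HasPullback e e] (sq : IsPullback f e' e g) [IsRegularEpi e] : IsRegularEpi e' := by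
  have : HasFiniteLimits (S C κ) := hasFiniteLimits_of_hasLimitsOfShape hκ
    fun J _ hJ => hasLimitsOfShape_S hJ
  have : PreservesFiniteLimits (closure C κ).ι :=
    preservesFiniteLimits_of_preservesLimitsOfShape _ hκ fun J _ hJ => preservesLimitsOfShape_ι hJ
  have := adj.rightAdjoint_preservesLimits
  obtain ⟨Q, q, i, hqi, hq, hi⟩ := exists_factorisation adj e
  have sq' := sq.map (V C κ)
  rw [← hqi] at sq'
  have sq₂ := IsPullback.of_hasPullback i ((V C κ).map g)
  let q' : (V C κ).obj A' ⟶ pullback i ((V C κ).map g) :=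
    pullback.lift ((V C κ).map f ≫ q) ((V C κ).map e') (by rw [Category.assoc, sq'.w])
  have sq₁ : IsPullback ((V C κ).map f) q' q (pullback.fst i ((V C κ).map g)) := by
    refine IsPullback.of_bot ?_ (pullback.lift_fst _ _ _).symm sq₂
    rwa [pullback.lift_snd]
  have hq' : ∀ X, Function.Surjective (q'.hom.app X) := fun X x => by
    obtain ⟨y, hy⟩ := hq X ((pullback.fst i ((V C κ).map g)).hom.app X x)
    obtain ⟨z, -, hz⟩ := Types.exists_of_isPullback
      ((sq₁.map (closure C κ).ι).map ((evaluation _ _).obj X)) y x hy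
    exact ⟨z, hz⟩
  have := isRegularEpi_of_surjective hκ q' hq'
  have h1 := isRegularEpi_map adj q'
  have : IsIso (L.map (pullback.snd i ((V C κ).map g))) := (sq₂.map L).isIso_snd_of_isIso
  refine isRegularEpi_of_map adj e' ?_
  have : L.map ((V C κ).map e') = L.map q' ≫ L.map (pullback.snd i ((V C κ).map g)) := by
    rw [← L.map_comp, pullback.lift_snd]
  rw [this]
  exact (MorphismProperty.cancel_right_of_respectsIso (.regularEpi C) _ _).2 h1

/-- Effectivity of equivalence relations: in `S C κ` the equivalence relation is the kernel pair of
its coequaliser, and `L` preserves kernel pairs. -/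
lemma exists_isKernelPair [PreservesFiniteLimits L] (hκ : Cardinal.aleph0 ≤ κ) {R X : C}
    {a b : R ⟶ X} (h : IsEquivalenceRelation a b) : ∃ (Y : C) (q : X ⟶ Y), IsKernelPair q a b := by
  have : HasFiniteLimits (S C κ) := hasFiniteLimits_of_hasLimitsOfShape hκ
    fun J _ hJ => hasLimitsOfShape_S hJ
  have : PreservesFiniteLimits (closure C κ).ι :=
    preservesFiniteLimits_of_preservesLimitsOfShape _ hκ fun J _ hJ => preservesLimitsOfShape_ι hJ
  obtain ⟨s, hs, hs'⟩ := (h.equivalence X).refl (𝟙 X)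
  have hab : IsReflexivePair (yoneda.map a) (yoneda.map b) := .mk' (yoneda.map s)
    (by rw [← Functor.map_comp, hs]; simp)
    (by rw [← Functor.map_comp, hs']; simp)
  have hc := coequalizerIsCoequalizer (yoneda.map a) (yoneda.map b)
  let Q : S C κ := ⟨_, closure.reflexiveCoequalizer _ _ hab _ hc
    (closure.representable _) (closure.representable _)⟩
  let q : (V C κ).obj X ⟶ Q := ObjectProperty.homMk (coequalizer.π _ _)
  have sq : IsPullback (yoneda.map a) (yoneda.map b) q.hom q.hom := by
    have w : yoneda.map a ≫ q.hom = yoneda.map b ≫ q.hom := coequalizer.condition _ _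
    refine ⟨⟨w⟩, ⟨evaluationJointlyReflectsLimits _ fun T =>
      (isLimitMapConePullbackConeEquiv ((evaluation _ _).obj T) w).symm
        ((Types.isPullback_iff _ _ _ _).2 ⟨?_, ?_, ?_⟩).isLimit⟩⟩
    · exact NatTrans.congr_app w T
    · rintro r s ⟨h₁, h₂⟩
      exact h.jointly_mono r s h₁ h₂
    · intro x y hxy
      exact presheaf_coequalizer_rel hc (h.equivalence T.unop) (fun r => ⟨r, rfl, rfl⟩) hxy
  have sq' : IsKernelPair q ((V C κ).map a) ((V C κ).map b) := by
    exact IsPullback.of_map (closure C κ).ι (ObjectProperty.hom_ext _ sq.w) sq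
  refine ⟨_, inv (adj.counit.app X) ≫ L.map q, (sq'.map L).of_iso (asIso (adj.counit.app R))
    (asIso (adj.counit.app X)) (asIso (adj.counit.app X)) (Iso.refl _) (adj.counit.naturality a)
    (adj.counit.naturality b) (by simp) (by simp)⟩

end Adjoint

end

section

variable {C : Type u} [Category.{v} C]

variable {κ : Cardinal.{v}}

lemma hasColimitsOfShape_S {K : Type v} [SmallCategory K] [IsFiltered K]
    (hK : HasCardinalLT (Arrow K) (prime κ)) : HasColimitsOfShape K (S C κ) := by
  have := isClosedUnderColimitsOfShape_closure (C := C) hK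
  infer_instance

lemma preservesColimitsOfShape_ι {K : Type v} [SmallCategory K] [IsFiltered K]
    (hK : HasCardinalLT (Arrow K) (prime κ)) : PreservesColimitsOfShape K (closure C κ).ι := by
  have := isClosedUnderColimitsOfShape_closure (C := C) hK
  infer_instance

/-- If a functor preserves limits of shape `J` and inverts the components of a natural
transformation, then it inverts the induced map of limits. -/
lemma isIso_map_of_isLimit {D E J : Type*} [Category* D] [Category* E] [Category* J] (L : D ⥤ E)
    [PreservesLimitsOfShape J L] {F G : J ⥤ D} (α : F ⟶ G) (hα : ∀ j, IsIso (L.map (α.app j)))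
    {s : Cone F} (hs : IsLimit s) {t : Cone G} (ht : IsLimit t) (u : s.pt ⟶ t.pt)
    (hu : ∀ j, u ≫ t.π.app j = s.π.app j ≫ α.app j) : IsIso (L.map u) := by
  have hα' : ∀ j, IsIso ((Functor.whiskerRight α L).app j) := hα
  have : IsIso (Functor.whiskerRight α L) := NatIso.isIso_of_isIso_app _
  have hu' : L.map u = ((isLimitOfPreserves L hs).conePointsIsoOfNatIso (isLimitOfPreserves L ht)
      (asIso (Functor.whiskerRight α L))).hom := by
    refine (isLimitOfPreserves L ht).hom_ext fun j => ?_
    rw [IsLimit.conePointsIsoOfNatIso_hom_comp]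
    change L.map u ≫ L.map (t.π.app j) = L.map (s.π.app j) ≫ L.map (α.app j)
    rw [← L.map_comp, ← L.map_comp, hu]
  rw [hu']
  infer_instance

section Adjoint

variable {L : S C κ ⥤ C} (adj : L ⊣ V C κ)

include adj

/-- Stability of regular epimorphisms under products: products of surjections are surjections, and
`L` inverts products of maps that it inverts. -/
lemma isRegularEpi_piMap (hκ : Cardinal.aleph0 ≤ κ) [HasFiniteLimits C] {I : Type v}
    (hI : HasCardinalLT (Arrow (Discrete I)) κ)
    [PreservesLimitsOfShape (Discrete I) L] [HasProductsOfShape I C] (A B : I → C)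
    (e : ∀ i, A i ⟶ B i) (he : ∀ i, IsRegularEpi (e i)) : IsRegularEpi (Limits.Pi.map e) := by
  have := hasLimitsOfShape_S (C := C) hI
  have := preservesLimitsOfShape_ι (C := C) hI
  have := adj.rightAdjoint_preservesLimits
  choose Q q i hqi hq hi using fun j => exists_factorisation adj (e j)
  have hB := isLimitFanMkObjOfIsLimit (V C κ) B _ (productIsProduct B)
  let q' : (V C κ).obj (∏ᶜ A) ⟶ ∏ᶜ Q := Pi.lift fun j => (V C κ).map (Pi.π A j) ≫ q j
  let i' : ∏ᶜ Q ⟶ (V C κ).obj (∏ᶜ B) := Fan.IsLimit.lift hB fun j => Pi.π Q j ≫ i j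
  have hi' : ∀ j, i' ≫ (V C κ).map (Pi.π B j) = Pi.π Q j ≫ i j := fun j =>
    Fan.IsLimit.fac hB _ j
  have hqi' : q' ≫ i' = (V C κ).map (Limits.Pi.map e) := by
    refine Fan.IsLimit.hom_ext hB _ _ fun j => ?_
    change (q' ≫ i') ≫ (V C κ).map (Pi.π B j) =
      (V C κ).map (Limits.Pi.map e) ≫ (V C κ).map (Pi.π B j)
    rw [Category.assoc, hi', ← Category.assoc, Pi.lift_π, Category.assoc, hqi, ← Functor.map_comp,
      ← Functor.map_comp, Pi.map_π]
  have hq' : ∀ X, Function.Surjective (q'.hom.app X) := fun X x => by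
    choose a ha using fun j => hq j X ((Pi.π Q j).hom.app X x)
    refine ⟨Pi.lift a, presheaf_limit_ext
      (isLimitOfPreserves (closure C κ).ι (productIsProduct Q)) fun ⟨j⟩ => ?_⟩
    refine Eq.trans ?_ (ha j)
    have h1 : q' ≫ Pi.π Q j = (V C κ).map (Pi.π A j) ≫ q j := Pi.lift_π _ _
    refine (ConcreteCategory.congr_hom (NatTrans.congr_app (congrArg (fun t => t.hom) h1) X)
      (Pi.lift a)).trans ?_
    exact congrArg ((q j).hom.app X) (Pi.lift_π a j)
  have := isRegularEpi_of_surjective hκ q' hq'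
  have h1 := isRegularEpi_map adj q'
  have : IsIso (L.map i') := isIso_map_of_isLimit L
    (Discrete.natTrans (F := Discrete.functor Q) (G := Discrete.functor fun j => (V C κ).obj (B j))
      fun j => i j.as) (fun j => hi j.as) (productIsProduct Q) hB i' fun j => hi' j.as
  refine isRegularEpi_of_map adj _ ?_
  rw [← hqi', L.map_comp]
  exact (MorphismProperty.cancel_right_of_respectsIso (.regularEpi C) _ _).2 h1

/-- Finite limits commute with filtered colimits: these colimits in `C` are computed by applying
`V`, taking the colimit in `S C κ`, and applying `L`, and each of these preserves finite limits. -/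
lemma preservesFiniteLimits_colim (hκ : Cardinal.aleph0 ≤ κ) [PreservesFiniteLimits L]
    {K : Type v} [SmallCategory K] [IsFiltered K] [HasFiniteLimits C]
    (hK : HasCardinalLT (Arrow K) (prime κ)) [HasColimitsOfShape K C] :
    PreservesFiniteLimits (colim : (K ⥤ C) ⥤ C) := by
  have : HasFiniteLimits (S C κ) := hasFiniteLimits_of_hasLimitsOfShape hκ
    fun J _ hJ => hasLimitsOfShape_S hJ
  have : PreservesFiniteLimits (closure C κ).ι :=
    preservesFiniteLimits_of_preservesLimitsOfShape _ hκ fun J _ hJ => preservesLimitsOfShape_ι hJ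
  have := hasColimitsOfShape_S (C := C) hK
  have := preservesColimitsOfShape_ι (C := C) hK
  have := adj.rightAdjoint_preservesLimits
  have := adj.leftAdjoint_preservesColimits
  have : HasExactColimitsOfShape K (Type v) := ⟨inferInstance⟩
  have : HasExactColimitsOfShape K (S C κ) :=
    HasExactColimitsOfShape.domain_of_functor K (closure C κ).ι
  have h1 : PreservesFiniteLimits ((Functor.whiskeringRight K C (S C κ)).obj (V C κ)) :=
    ⟨fun _ _ _ => inferInstance⟩
  have h2 : PreservesFiniteLimits (colim ⋙ L : (K ⥤ S C κ) ⥤ C) :=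
    comp_preservesFiniteLimits _ _
  let e : (Functor.whiskeringRight K C (S C κ)).obj (V C κ) ⋙ colim ⋙ L ≅ colim :=
    Functor.isoWhiskerLeft _ (preservesColimitNatIso L) ≪≫
      Functor.isoWhiskerRight ((Functor.whiskeringRight K C C).mapIso (asIso adj.counit)) colim ≪≫
      Functor.leftUnitor _
  have : PreservesFiniteLimits
    ((Functor.whiskeringRight K C (S C κ)).obj (V C κ) ⋙ colim ⋙ L) :=
    comp_preservesFiniteLimits _ _
  exact preservesFiniteLimits_of_natIso e

/-- If `c` is a colimit cocone in `C` then `L` inverts the comparison with the colimit in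
`S C κ`. -/
lemma isIso_map_desc {K : Type v} [SmallCategory K] {D : K ⥤ C} {c : Cocone D}
    (hc : IsColimit c) [HasColimit (D ⋙ V C κ)] :
    IsIso (L.map (colimit.desc (D ⋙ V C κ) ((V C κ).mapCocone c))) := by
  have := adj.leftAdjoint_preservesColimits
  have := isEquivalence_V_comp adj
  have h1 := isColimitOfPreserves L (colimit.isColimit (D ⋙ V C κ))
  have h2 : IsColimit (L.mapCocone ((V C κ).mapCocone c)) := isColimitOfPreserves (V C κ ⋙ L) hc
  have : L.map (colimit.desc (D ⋙ V C κ) ((V C κ).mapCocone c)) =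
      (h1.coconePointUniqueUpToIso h2).hom := by
    refine h1.hom_ext fun k => ?_
    rw [IsColimit.comp_coconePointUniqueUpToIso_hom]
    change L.map _ ≫ L.map _ = _
    rw [← L.map_comp]
    exact congrArg L.map (colimit.ι_desc _ _)
  rw [this]
  infer_instance

/-- Distributivity of filtered colimits over products, which holds for sets, hence for the colimits
of the diagrams `D i ⋙ V C κ` in `S C κ`. -/
lemma isColimit_coconePointwiseProduct {I : Type v} (hI : HasCardinalLT (Arrow (Discrete I)) κ)
    [PreservesLimitsOfShape (Discrete I) L] [HasProductsOfShape I C] {K : I → Type v}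
    [∀ i, SmallCategory (K i)] [∀ i, IsFiltered (K i)]
    (hK : ∀ i, HasCardinalLT (Arrow (K i)) (prime κ)) (D : ∀ i, K i ⥤ C) (c : ∀ i, Cocone (D i))
    (hc : ∀ i, IsColimit (c i)) : Nonempty (IsColimit (coconePointwiseProduct c)) := by
  have := hasLimitsOfShape_S (C := C) hI
  have := preservesLimitsOfShape_ι (C := C) hI
  have := adj.rightAdjoint_preservesLimits
  have := adj.leftAdjoint_preservesColimits
  have := fun i => hasColimitsOfShape_S (C := C) (hK i)
  have := fun i => preservesColimitsOfShape_ι (C := C) (hK i)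
  have := isEquivalence_V_comp adj
  let Q : I → S C κ := fun i => colimit (D i ⋙ V C κ)
  have hQ := isLimitOfPreserves (closure C κ).ι (productIsProduct Q)
  have hQ' := fun i => isColimitOfPreserves (closure C κ).ι (colimit.isColimit (D i ⋙ V C κ))
  let p : ∀ (k : ∀ i, K i) (i : I), (pointwiseProduct D).obj k ⟶ (D i).obj (k i) := fun k i =>
    Pi.π (fun i => (D i).obj (k i)) i
  have hp : ∀ {k l : ∀ i, K i} (f : k ⟶ l) (i : I), (pointwiseProduct D).map f ≫ p l i =
      p k i ≫ (D i).map (f i) := fun f i => Pi.map_π _ _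
  let g : ∀ (i : I) (k : K i), (V C κ).obj ((D i).obj k) ⟶ Q i := fun i k =>
    colimit.ι (D i ⋙ V C κ) k
  have hg : ∀ (i : I) {k l : K i} (f : k ⟶ l), (V C κ).map ((D i).map f) ≫ g i l = g i k :=
    fun i _ _ f => colimit.w (D i ⋙ V C κ) f
  let ψ : ∀ k : ∀ i, K i, (V C κ).obj ((pointwiseProduct D).obj k) ⟶ ∏ᶜ Q := fun k =>
    Pi.lift fun i => (V C κ).map (p k i) ≫ g i (k i)
  have hψ : ∀ k i, ψ k ≫ Pi.π Q i = (V C κ).map (p k i) ≫ g i (k i) := fun k i => Pi.lift_π _ _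
  let s : Cocone (pointwiseProduct D ⋙ V C κ) :=
    { pt := ∏ᶜ Q
      ι :=
        { app := ψ
          naturality := fun k l f => by
            refine Pi.hom_ext _ _ fun i => ?_
            change ((V C κ).map ((pointwiseProduct D).map f) ≫ ψ l) ≫ Pi.π Q i =
              (ψ k ≫ 𝟙 _) ≫ Pi.π Q i
            rw [Category.assoc, hψ, ← Category.assoc, ← Functor.map_comp, hp, Functor.map_comp,
              Category.assoc, Category.comp_id, hψ, hg] } }
  have hψ' : ∀ (k : ∀ i, K i) (i : I) {X : Cᵒᵖ} (x : X.unop ⟶ (pointwiseProduct D).obj k),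
      (Pi.π Q i).hom.app X ((ψ k).hom.app X x) = (g i (k i)).hom.app X (x ≫ p k i) :=
    fun k i X x =>
      ConcreteCategory.congr_hom (NatTrans.congr_app (congrArg (fun t => t.hom) (hψ k i)) X) x
  -- Distributivity in `S C κ`, checked on elements: the axiom of choice selects an index or a
  -- later stage in each `K i`.
  have hs : IsColimit s := by
    refine isColimitOfReflects (closure C κ).ι (evaluationJointlyReflectsColimits _ fun X =>
      Types.FilteredColimit.isColimitOf _ _ (fun x => ?_) fun k l x y hxy => ?_)
    · choose k a ha using fun i => presheaf_colimit_exists (hQ' i) ((Pi.π Q i).hom.app X x)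
      refine ⟨k, Pi.lift a, presheaf_limit_ext hQ fun ⟨i⟩ => ?_⟩
      refine Eq.trans (ha i).symm (Eq.trans ?_ (hψ' k i (Pi.lift a)).symm)
      exact congrArg ((g i (k i)).hom.app X) (Pi.lift_π a i).symm
    · have h1 := fun i => (hψ' k i x).symm.trans
        ((congrArg ((Pi.π Q i).hom.app X) hxy).trans (hψ' l i y))
      have h2 := fun i => (Types.FilteredColimit.isColimit_eq_iff _
        (isColimitOfPreserves ((evaluation _ _).obj X) (hQ' i))).1 (h1 i)
      choose m f f' hff' using h2
      refine ⟨m, f, f', Pi.hom_ext (f := fun i => (D i).obj (m i)) _ _ fun i => ?_⟩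
      let x' : X.unop ⟶ (pointwiseProduct D).obj k := x
      let y' : X.unop ⟶ (pointwiseProduct D).obj l := y
      change (x' ≫ (pointwiseProduct D).map f) ≫ p m i = (y' ≫ (pointwiseProduct D).map f') ≫ p m i
      rw [Category.assoc, Category.assoc, hp, hp, ← Category.assoc, ← Category.assoc]
      exact hff' i
  have hX := isLimitFanMkObjOfIsLimit (V C κ) (fun i => (c i).pt) _ (productIsProduct _)
  let t : ∀ i, Q i ⟶ (V C κ).obj (c i).pt := fun i =>
    colimit.desc (D i ⋙ V C κ) ((V C κ).mapCocone (c i))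
  have hgt : ∀ i k, g i k ≫ t i = (V C κ).map ((c i).ι.app k) := fun i k => colimit.ι_desc _ _
  let u : ∏ᶜ Q ⟶ (V C κ).obj (∏ᶜ fun i => (c i).pt) := Fan.IsLimit.lift hX fun i => Pi.π Q i ≫ t i
  have hu : ∀ i, u ≫ (V C κ).map (Pi.π (fun i => (c i).pt) i) = Pi.π Q i ≫ t i := fun i =>
    Fan.IsLimit.fac hX _ i
  have hu' : IsIso (L.map u) := isIso_map_of_isLimit L
    (Discrete.natTrans (F := Discrete.functor Q)
      (G := Discrete.functor fun i => (V C κ).obj (c i).pt) fun i => t i.as)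
    (fun i => isIso_map_desc adj (hc i.as)) (productIsProduct Q) hX u fun i => hu i.as
  have hψu : ∀ k, ψ k ≫ u = (V C κ).map ((coconePointwiseProduct c).ι.app k) := fun k => by
    refine Fan.IsLimit.hom_ext hX _ _ fun i => ?_
    change (ψ k ≫ u) ≫ (V C κ).map (Pi.π (fun i => (c i).pt) i) =
      (V C κ).map _ ≫ (V C κ).map (Pi.π (fun i => (c i).pt) i)
    rw [Category.assoc, hu, ← Category.assoc, hψ, Category.assoc, hgt, ← Functor.map_comp,
      coconePointwiseProduct_ι_app]
    exact (congrArg (V C κ).map (Pi.map_π (fun i => (c i).ι.app (k i)) i).symm).trans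
      ((V C κ).map_comp _ _)
  have h3 : IsColimit ((V C κ ⋙ L).mapCocone (coconePointwiseProduct c)) := by
    refine IsColimit.ofIsoColimit (isColimitOfPreserves L hs)
      (Cocone.ext (@asIso _ _ _ _ (L.map u) hu') ?_)
    intro k
    change L.map (ψ k) ≫ L.map u = L.map ((V C κ).map _)
    rw [← L.map_comp, hψu]
    rfl
  exact ⟨isColimitOfReflects (V C κ ⋙ L) h3⟩

end Adjoint

theorem IsAlgebraicallyExact.exactnessConditions (hκ : κ.IsRegular) (hlim : HasLimitsLT C κ)
    (hrefl : HasReflexiveCoequalizers C) (hfilt : HasFilteredColimitsLT C (prime κ))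
    (h : IsAlgebraicallyExact C κ) : ExactnessConditions C κ := by
  obtain ⟨L, ⟨adj⟩, hL⟩ := h
  have hL' := preservesFiniteLimits_of_preservesLimitsOfShape L hκ.aleph0_le hL
  have hC : HasFiniteLimits C := hasFiniteLimits_of_hasLimitsOfShape hκ.aleph0_le hlim
  refine ⟨hκ, hlim, hfilt, ⟨⟨?_, ⟨fun sq he => ?_⟩⟩, fun R X a b hab =>
    exists_isKernelPair adj hκ.aleph0_le hab⟩, fun K _ _ hK => ?_, fun I hI => ?_,
      fun I hI K _ _ hK D c hc => ?_⟩
  · intro X Y Z f g₁ g₂ hf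
    have : IsReflexivePair g₁ g₂ := .mk' (hf.lift (𝟙 X) (𝟙 X) rfl) (hf.lift_fst _ _ _)
      (hf.lift_snd _ _ _)
    exact hrefl.has_coeq g₁ g₂
  · have : IsRegularEpi _ := he
    exact isRegularEpi_of_isPullback adj hκ.aleph0_le sq
  · have := hfilt K hK
    exact preservesFiniteLimits_colim adj hκ.aleph0_le hK
  · have := hlim.hasProductsOfShape hI
    have hI' := (hasCardinalLT_arrow_discrete_iff κ).2 hI
    have := hL _ hI'
    exact isRegularEpi_piMap adj hκ.aleph0_le hI'
  · have := hlim.hasProductsOfShape hI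
    have hI' := (hasCardinalLT_arrow_discrete_iff κ).2 hI
    have := hL _ hI'
    exact isColimit_coconePointwiseProduct adj hI' hK D c fun i => (hc i).some

end

end AlgExact

theorem mainTheorem2 {C : Type u} [Category.{v} C] (κ : Cardinal.{v}) (hκ : κ.IsRegular)
    (hlim : AlgExact.HasLimitsLT C κ) (hrefl : HasReflexiveCoequalizers C)
    (hfilt : AlgExact.HasFilteredColimitsLT C (AlgExact.prime κ)) :
    AlgExact.IsAlgebraicallyExact C κ ↔
      AlgExact.IsBarrExact C ∧
      AlgExact.FiniteLimitsCommute hfilt ∧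
      AlgExact.RegularEpisStableByProducts hlim ∧
      AlgExact.FilteredColimitsDistribute hlim (AlgExact.prime κ) := by
  constructor
  · intro h
    have h' := h.exactnessConditions hκ hlim hrefl hfilt
    exact ⟨h'.isBarrExact, h'.commute, h'.products, h'.distribute⟩
  · rintro ⟨h₁, h₂, h₃, h₄⟩
    have := h₁.1
    exact AlgExact.ExactnessConditions.isAlgebraicallyExact
      ⟨hκ, hlim, hfilt, h₁, h₂, h₃, h₄⟩ hrefl
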